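/- Let $e\ge 2$ and $r\ge 2$ be integers. Let $B(e,e,r)$ be the braid group of the complex reflection group $G(e,e,r)$, given by its Broué–Malle–Rouquier presentation: it has generators $t_0,t_1,s_3,\dots,s_r$ and relations - $s_is_js_i=s_js_is_j$ if $|i-j|=1$, and $s_is_j=s_js_i$ if $|i-j|>1$; - $t_1t_0t_1\cdots=t_0t_1t_0\cdots$ ($e$ factors on each side); - $s_3t_is_3=t_is_3t_i$ for $i=0,1$; - $s_jt_i=t_is_j$ for $i=0,1$ and $4\le j\le r$; - $(s_3t_1t_0)^2=(t_1t_0s_3)^2$ (the relations involving $s_3$ being absent if $r=2$). Put $t_i=t_{i-1}t_{i-2}t_{i-1}^{-1}$ for $2\le i\le e-1$, and index $t_0,\dots,t_{e-1}$ by $\mathbb{Z}/e$. Then there is an automorphism $\downarrow$ of $B(e,e,r)$, necessarily unique, with $t_i^{\downarrow}=t_{i-1}$ for all $i\in\mathbb{Z}/e$ and $s_j^{\downarrow}=s_j$ for all $3\le j\le r$; and the subgroup of $B(e,e,r)$ consisting of the elements fixed by $\downarrow$ is isomorphic to the Artin group $B(B_{r-1})$ of Coxeter type $B_{r-1}$ (for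 $r=2$, this is the infinite cyclic group). -/

import Mathlib

namespace BraidEER

/-- The alternating product `a * b * a * ⋯` with `n` factors, starting with `a`. -/
def altProd {G : Type*} [Monoid G] (a b : G) : ℕ → G
  | 0 => 1
  | n + 1 => a * altProd b a n

/-- The relators `⟨i j⟩^m (⟨j i⟩^m)⁻¹`, `m = M i j`, of the Artin group of a Coxeter matrix `M`.
An entry `M i j = 0` stands for `m = ∞`; it yields the trivial relator, that is, no relation. -/
def artinRelators {B : Type*} (M : CoxeterMatrix B) : Set (FreeGroup B) :=
  {w | ∃ i j : B, w = altProd (FreeGroup.of i) (FreeGroup.of j) (M i j) *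
    (altProd (FreeGroup.of j) (FreeGroup.of i) (M i j))⁻¹}

/-- The Artin (braid) group of a Coxeter matrix. -/
abbrev ArtinGroup {B : Type*} (M : CoxeterMatrix B) : Type _ :=
  PresentedGroup (artinRelators M)

/-- The generators `t₀, t₁, s₃, …, s_r` of the braid group of type `(e, e, r)`. -/
inductive Gen (r : ℕ) : Type
  | t (i : Fin 2) : Gen r
  | s (j : Set.Icc 3 r) : Gen r

/-- The generator `t₀` or `t₁`, in the free group. -/
def ft {r : ℕ} (i : Fin 2) : FreeGroup (Gen r) := FreeGroup.of (Gen.t i)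

/-- The generator `s_j`, in the free group. -/
def fs {r : ℕ} (j : Set.Icc 3 r) : FreeGroup (Gen r) := FreeGroup.of (Gen.s j)

/-- The defining relations (Broué–Malle–Rouquier) of the braid group of type `(e, e, r)`:
`Rel e r x y` says that `x = y` is one of them. -/
inductive Rel (e r : ℕ) : FreeGroup (Gen r) → FreeGroup (Gen r) → Prop
  | ss_braid (i j : Set.Icc 3 r) (h : (j : ℕ) = i + 1) :
      Rel e r (fs i * fs j * fs i) (fs j * fs i * fs j)
  | ss_comm (i j : Set.Icc 3 r) (h : (i : ℕ) + 1 < j) :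
      Rel e r (fs i * fs j) (fs j * fs i)
  | tt : Rel e r (altProd (ft 1) (ft 0) e) (altProd (ft 0) (ft 1) e)
  | st_braid (j : Set.Icc 3 r) (h : (j : ℕ) = 3) (i : Fin 2) :
      Rel e r (fs j * ft i * fs j) (ft i * fs j * ft i)
  | st_comm (j : Set.Icc 3 r) (h : 4 ≤ (j : ℕ)) (i : Fin 2) :
      Rel e r (fs j * ft i) (ft i * fs j)
  | stt (j : Set.Icc 3 r) (h : (j : ℕ) = 3) :
      Rel e r ((fs j * ft 1 * ft 0) ^ 2) ((ft 1 * ft 0 * fs j) ^ 2)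

/-- The braid group `B(e,e,r)`, by its Broué–Malle–Rouquier presentation. -/
abbrev BraidGroup (e r : ℕ) : Type :=
  PresentedGroup {w : FreeGroup (Gen r) | ∃ x y, Rel e r x y ∧ w = x * y⁻¹}

/-- The generator `s_j` of `B(e,e,r)`, for `3 ≤ j ≤ r`. -/
def s (e : ℕ) {r : ℕ} (j : Set.Icc 3 r) : BraidGroup e r := PresentedGroup.of (Gen.s j)

/-- The circle of elements of `B(e,e,r)` on the generators `t₁, t₀`:
`t_n = t_{n-1} t_{n-2} t_{n-1}⁻¹` for `n ≥ 2`. -/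
def circle (e r : ℕ) : ℕ → BraidGroup e r
  | 0 => PresentedGroup.of (Gen.t 0)
  | 1 => PresentedGroup.of (Gen.t 1)
  | n + 2 => circle e r (n + 1) * circle e r n * (circle e r (n + 1))⁻¹

/-- The elements `t_i` of `B(e,e,r)`, indexed by `ℤ/e` through the representatives
`0, 1, …, e - 1`. -/
def t (e r : ℕ) (i : ZMod e) : BraidGroup e r := circle e r i.val

/-- The subgroup of elements fixed by an automorphism. -/
def fixedSubgroup {G : Type*} [Group G] (φ : G ≃* G) : Subgroup G :=
  φ.toMonoidHom.eqLocus (MonoidHom.id G)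

end BraidEER

namespace BraidEER

/-! Adjoin the rotation. The semidirect product `ExtBraidGroup` of B(e,e,r) with ℤ/e is generated by
x = `rot` and σ₀, σ₁, … = t₀, s₃, …, s_r, which satisfy the Artin relations of type B_r together
with x^e = 1 (`isTypeB_rot`, `ext_generated`). An element of B(e,e,r) is fixed by ↓ exactly when it
commutes with x, so the matter is the centralizer of x.

Let N be generated by the conjugates x_k = (σ_{k-1}⋯σ₀) x (σ_{k-1}⋯σ₀)⁻¹, 0 ≤ k ≤ r-1. It is normal,
and it is a free product of r cyclic groups of order e: Artin's automorphisms yield a homomorphism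
`extToHolomorph` sending x_k to the k-th free generator. Let K be generated by δ = t₁t₀ and the s_j;
it is fixed by ↓. Every element has the form w a h with w = σ_{k-1}⋯σ₀, a ∈ N, h ∈ K
(`exists_eq_descProd_mul`). If it commutes with x, then so does w a, so x is conjugate to x_k under
N; distinct free factors force k = 0. Then a ∈ N centralizes x, hence is a power of x
(`mem_range_of_commute`), and it is trivial if the element lies in B(e,e,r). So the fixed subgroup
is K (`range_artinLift`).

Since δ, s₃, …, s_r satisfy the relations of type B_{r-1}, K is a quotient of that Artin group A.
For injectivity, B(e,e,r) maps to the braid group on r strands by t₀, t₁ ↦ σ₀, and A should be the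
index-r subgroup generated by σ₀², σ₁, …. The action induced from left translation of A is written
down explicitly on labels times A (`induced`); on label 0, the image of a ∈ A acts as left
multiplication by a (`artinLift_injective`). -/

/-- Elements `x, σ₀, …, σ_{n-1}` of a group satisfying the Artin relations of type `B_{n+1}`, where
`x` is the special generator. -/
structure IsTypeB {G : Type*} [Group G] (n : ℕ) (x : G) (σ : ℕ → G) : Prop where
  braid : ∀ i, i + 1 < n → σ i * σ (i + 1) * σ i = σ (i + 1) * σ i * σ (i + 1)
  comm : ∀ i j, i + 1 < j → j < n → Commute (σ i) (σ j)
  comm_x : ∀ i, 1 ≤ i → i < n → Commute x (σ i)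
  sq : 0 < n → x * σ 0 * x * σ 0 = σ 0 * x * σ 0 * x

/-- The conjugates `x_{k+1} = σ_k x_k σ_k⁻¹` of `x₀ = x`. -/
def conjSeq {G : Type*} [Group G] (x : G) (σ : ℕ → G) : ℕ → G
  | 0 => x
  | k + 1 => σ k * conjSeq x σ k * (σ k)⁻¹

/-- The product `σ_{k-1} ⋯ σ₀`. -/
def descProd {G : Type*} [Group G] (σ : ℕ → G) : ℕ → G
  | 0 => 1
  | k + 1 => σ k * descProd σ k

/-! ### Consequences of the type B relations for the conjugates x_k -/

section

variable {G : Type*} [Group G] {n : ℕ} {x : G} {σ : ℕ → G}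

theorem conjSeq_eq (x : G) (σ : ℕ → G) (k : ℕ) :
    conjSeq x σ k = descProd σ k * x * (descProd σ k)⁻¹ := by
  induction k with
  | zero => simp [conjSeq, descProd]
  | succ k ih => rw [conjSeq, ih, descProd]; group

theorem map_conjSeq {H : Type*} [Group H] (f : G →* H) (x : G) (σ : ℕ → G) (k : ℕ) :
    f (conjSeq x σ k) = conjSeq (f x) (fun i => f (σ i)) k := by
  induction k with
  | zero => rfl
  | succ k ih => simp [conjSeq, ih]

theorem conjSeq_congr {y : G} {τ : ℕ → G} (hx : x = y) {k : ℕ} (h : ∀ i < k, σ i = τ i) :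
    conjSeq x σ k = conjSeq y τ k := by
  induction k with
  | zero => exact hx
  | succ k ih => rw [conjSeq, conjSeq, ih fun i hi => h i (by omega), h k (by omega)]

theorem conjSeq_pow {e : ℕ} (h : x ^ e = 1) (k : ℕ) : conjSeq x σ k ^ e = 1 := by
  rw [conjSeq_eq, conj_pow, h, mul_one, mul_inv_cancel]

theorem braid_conj {a b : G} (h : a * b * a = b * a * b) : a * b * a * (a * b)⁻¹ = b := by
  rw [h]; group

namespace IsTypeB

variable (h : IsTypeB n x σ)
include h

theorem descProd_comm_of_lt {k i : ℕ} (hk : k < i) (hn : i < n) : Commute (σ i) (descProd σ k) := by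
  induction k with
  | zero => exact Commute.one_right _
  | succ k ih => exact ((h.comm k i hk hn).symm).mul_right (ih (by omega))

theorem conjSeq_comm_of_lt {k i : ℕ} (hk : k < i) (hn : i < n) : Commute (σ i) (conjSeq x σ k) := by
  rw [conjSeq_eq]
  have := h.descProd_comm_of_lt hk hn
  exact (this.mul_right (h.comm_x i (by omega) hn).symm).mul_right this.inv_right

/-- Moving right, σ_i commutes with the letters until it meets σ_{i+1} σ_i, where the braid relation
turns it into σ_{i+1}; this commutes with the remaining letters. -/
theorem mul_descProd_of_gt {k i : ℕ} (hk : i + 1 < k) (hn : k ≤ n) :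
    σ i * descProd σ k = descProd σ k * σ (i + 1) := by
  induction k with
  | zero => omega
  | succ k ih =>
    rcases Nat.lt_or_ge (i + 1) k with hik | hik
    · have c := (h.comm i k hik (by omega)).eq
      rw [descProd, ← mul_assoc, c, mul_assoc, ih hik (by omega), mul_assoc]
    · obtain rfl : k = i + 1 := by omega
      have c := (h.descProd_comm_of_lt (Nat.lt_succ_self i) (by omega)).eq
      simp only [descProd]
      calc σ i * (σ (i + 1) * (σ i * descProd σ i))
          = σ i * σ (i + 1) * σ i * descProd σ i := by group
        _ = σ (i + 1) * σ i * (σ (i + 1) * descProd σ i) := by rw [h.braid i (by omega)]; group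
        _ = _ := by rw [c]; group

theorem conjSeq_comm_of_gt {k i : ℕ} (hk : i + 1 < k) (hn : k ≤ n) :
    Commute (σ i) (conjSeq x σ k) := by
  have c := h.mul_descProd_of_gt hk hn
  have c' := (h.comm_x (i + 1) (by omega) (by omega)).eq
  rw [conjSeq_eq]
  have : σ i = descProd σ k * σ (i + 1) * (descProd σ k)⁻¹ := by rw [← c]; group
  rw [this]
  show _ = _
  calc _ = descProd σ k * (σ (i + 1) * x) * (descProd σ k)⁻¹ := by group
    _ = _ := by rw [← c']; group

/-- Conjugation by σ_k σ_{k+1} carries the pair (x_k, σ_k) to (x_{k+1}, σ_{k+1}), so the length-four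
relation propagates from k = 0. -/
theorem conjSeq_sq {k : ℕ} (hk : k < n) :
    conjSeq x σ k * σ k * conjSeq x σ k * σ k = σ k * conjSeq x σ k * σ k * conjSeq x σ k := by
  induction k with
  | zero => exact h.sq hk
  | succ k ih =>
    have e1 := braid_conj (h.braid k hk)
    have e2 : conjSeq x σ (k + 1) = σ k * σ (k + 1) * conjSeq x σ k * (σ k * σ (k + 1))⁻¹ := by
      have := (h.conjSeq_comm_of_lt (Nat.lt_succ_self k) (by omega)).eq
      rw [mul_assoc (σ k), this, conjSeq]; group
    have := congrArg (MulAut.conj (σ k * σ (k + 1))) (ih (by omega))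
    simpa only [map_mul (MulAut.conj (σ k * σ (k + 1))) (_ : G) (_ : G), MulAut.conj_apply, e1,
      ← e2] using this

/-- `σ_k² x_k σ_k⁻² = x_{k+1}⁻¹ x_k x_{k+1}`. -/
theorem conj_conjSeq_succ {k : ℕ} (hk : k < n) :
    σ k * conjSeq x σ (k + 1) * (σ k)⁻¹ =
      (conjSeq x σ (k + 1))⁻¹ * conjSeq x σ k * conjSeq x σ (k + 1) := by
  have := h.conjSeq_sq hk
  rw [conjSeq]
  generalize conjSeq x σ k = y at *
  generalize σ k = s at *
  calc s * (s * y * s⁻¹) * s⁻¹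
      = (s * y * s⁻¹)⁻¹ * (s * y * s * y) * s⁻¹ * s⁻¹ := by group
    _ = _ := by rw [← this]; group

end IsTypeB

end

/-! ### Cyclic groups of order e -/

/-- The homomorphism from the cyclic group of order `e` determined by an `e`-torsion element. -/
def cyclicLift {G : Type*} [Group G] {e : ℕ} (g : G) (h : g ^ e = 1) :
    Multiplicative (ZMod e) →* G :=
  AddMonoidHom.toMultiplicativeLeft
    (ZMod.lift e ⟨zmultiplesHom (Additive G) (Additive.ofMul g), by
      simp [zmultiplesHom_apply, ← ofMul_pow, h]⟩)

/-- The generator of the cyclic group of order `e`. -/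
def cyclicGen (e : ℕ) : Multiplicative (ZMod e) := Multiplicative.ofAdd 1

theorem cyclicLift_gen {G : Type*} [Group G] {e : ℕ} (g : G) (h : g ^ e = 1) :
    cyclicLift g h (cyclicGen e) = g := by
  have := ZMod.lift_coe e ⟨zmultiplesHom (Additive G) (Additive.ofMul g), by
      simp [zmultiplesHom_apply, ← ofMul_pow, h]⟩ 1
  simp only [Int.cast_one, zmultiplesHom_apply, one_zsmul] at this
  exact congrArg Additive.toMul this

theorem cyclicGen_pow (e : ℕ) : cyclicGen e ^ e = 1 := by
  rw [cyclicGen, ← ofAdd_nsmul]; simp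

theorem exists_zpow_cyclicGen {e : ℕ} (a : Multiplicative (ZMod e)) :
    ∃ k : ℤ, a = cyclicGen e ^ k := by
  obtain ⟨k, hk⟩ := ZMod.intCast_surjective a.toAdd
  exact ⟨k, by rw [cyclicGen, ← ofAdd_zsmul]; simp [hk]⟩

theorem cyclicGen_ne_one {e : ℕ} (he : 2 ≤ e) : cyclicGen e ≠ 1 := by
  have : Fact (1 < e) := ⟨he⟩
  exact fun h => one_ne_zero (α := ZMod e) (congrArg Multiplicative.toAdd h)

theorem cyclic_hom_ext {G : Type*} [Group G] {e : ℕ} {f g : Multiplicative (ZMod e) →* G}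
    (h : f (cyclicGen e) = g (cyclicGen e)) : f = g := by
  refine MonoidHom.ext fun a => ?_
  obtain ⟨k, rfl⟩ := exists_zpow_cyclicGen a
  simp only [map_zpow, h]

/-! ### Centralizers in free products of abelian groups -/

section Centralizer

open Monoid CoprodI

variable {ι : Type*} {G : ι → Type*}

theorem NeWord.length_inv [∀ i, Group (G i)] {i j : ι} (w : NeWord G i j) :
    w.inv.toList.length = w.toList.length := by
  induction w with
  | singleton => rfl
  | append w₁ hne w₂ h₁ h₂ => simp [NeWord.inv, NeWord.toList, h₁, h₂, add_comm]

theorem NeWord.prod_ne_one [∀ i, Group (G i)] {i j : ι} (w : NeWord G i j) : w.prod ≠ 1 := by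
  classical
  intro h
  have h' : w.toWord = Word.empty :=
    Word.equiv.symm.injective (h.trans Word.prod_empty.symm)
  exact w.toList_ne_nil (congrArg Word.toList h')

/-- The centralizer of a nontrivial element of an abelian factor of a free product is this
factor. -/
theorem mem_range_of_commute [∀ i, CommGroup (G i)] {i₀ : ι} {a : G i₀} (ha : a ≠ 1)
    {p : CoprodI G} (hp : Commute (of a) p) : p ∈ (of : G i₀ →* CoprodI G).range := by
  classical
  -- Induction on the length of the reduced word. A first letter in the factor `i₀` commutes with a
  -- and can be stripped; a last letter there is treated by passing to the inverse.
  have key : ∀ n (w : Word G), w.toList.length ≤ n → Commute (of a) w.prod →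
      w.prod ∈ (of : G i₀ →* CoprodI G).range := by
    intro n
    induction n with
    | zero =>
      intro w hw _
      have : w = Word.empty := Word.ext (List.length_eq_zero_iff.mp (Nat.le_zero.mp hw))
      rw [this, Word.prod_empty]
      exact one_mem _
    | succ n ih =>
      have step : ∀ j (w : NeWord G i₀ j), w.toList.length ≤ n + 1 → Commute (of a) w.prod →
          w.prod ∈ (of : G i₀ →* CoprodI G).range := by
        intro j w hw hc
        obtain ⟨p, hp⟩ : ∃ p : Word.Pair G i₀, Word.rcons p = w.toWord :=
          ⟨Word.equivPair i₀ w.toWord, (Word.equivPair i₀).symm_apply_apply w.toWord⟩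
        have hprod : w.prod = of p.head * p.tail.prod := by
          rw [NeWord.prod, ← hp, Word.prod_rcons]
        have hhead : p.head ≠ 1 := by
          intro h1
          have : w.toWord = p.tail := by rw [← hp, Word.rcons, dif_pos h1]
          apply p.fstIdx_ne
          rw [← this, Word.fstIdx]
          show Option.map _ w.toList.head? = _
          rw [NeWord.toList_head?]; rfl
        have hlen : p.tail.toList.length ≤ n := by
          have : w.toWord.toList = ⟨i₀, p.head⟩ :: p.tail.toList := by
            rw [← hp, Word.rcons, dif_neg hhead]; rfl
          have h2 : w.toList.length = p.tail.toList.length + 1 := by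
            rw [show w.toList = _ from this]; rfl
          omega
        rw [hprod]
        refine mul_mem ⟨_, rfl⟩ (ih _ hlen ?_)
        have hc' : Commute (of a) (of p.head : CoprodI G) :=
          (Commute.all a p.head).map of
        have : p.tail.prod = (of p.head)⁻¹ * w.prod := by rw [hprod]; group
        rw [this]
        exact hc'.inv_right.mul_right hc
      intro w hw hc
      by_cases hemp : w = Word.empty
      · rw [hemp, Word.prod_empty]; exact one_mem _
      obtain ⟨i, j, w', rfl⟩ := NeWord.of_word w hemp
      by_cases hi : i = i₀
      · subst hi; exact step _ w' hw hc
      by_cases hj : j = i₀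
      · subst hj
        have := step _ w'.inv (by rw [NeWord.length_inv]; exact hw)
          (by rw [NeWord.inv_prod]; exact Commute.inv_right hc)
        rw [NeWord.inv_prod] at this
        exact inv_mem_iff.mp this
      -- If neither end lies in the factor `i₀`, then w a w⁻¹ a⁻¹ is a nonempty reduced word, hence
      -- not 1, against commutation.
      · exfalso
        apply NeWord.prod_ne_one ((((w'.append hj (NeWord.singleton a ha)).append (Ne.symm hj)
          w'.inv)).append hi (NeWord.singleton a⁻¹ (inv_ne_one.mpr ha)))
        simp only [NeWord.append_prod, NeWord.prod_singleton, NeWord.inv_prod, map_inv]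
        have : of a * w'.prod = w'.prod * of a := hc
        rw [← this]; group
  have := key _ (Word.equiv p) le_rfl
  rw [show (Word.equiv p).prod = p from Word.equiv.symm_apply_apply p] at this
  exact this hp

end Centralizer

/-! ### Artin's braid action on a free product of cyclic groups -/

section FreeProduct

open Monoid CoprodI

/-- The free product of countably many cyclic groups of order `e`. -/
abbrev CyclicFreeProd (e : ℕ) : Type := CoprodI fun _ : ℕ => Multiplicative (ZMod e)

namespace CyclicFreeProd

variable {e : ℕ}

/-- The standard generators of the free product of cyclic groups. -/
def gen (e k : ℕ) : CyclicFreeProd e := of (i := k) (cyclicGen e)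

theorem gen_pow (k : ℕ) : gen e k ^ e = 1 := by
  rw [gen, ← map_pow, cyclicGen_pow, map_one]

/-- The homomorphism determined by a sequence of `e`-torsion elements. -/
def lift {G : Type*} [Group G] (y : ℕ → G) (h : ∀ k, y k ^ e = 1) : CyclicFreeProd e →* G :=
  CoprodI.lift fun k => cyclicLift (y k) (h k)

@[simp]
theorem lift_gen {G : Type*} [Group G] (y : ℕ → G) (h : ∀ k, y k ^ e = 1) (k : ℕ) :
    lift y h (gen e k) = y k := by
  rw [lift, gen, lift_of, cyclicLift_gen]

theorem hom_ext {G : Type*} [Group G] {f g : CyclicFreeProd e →* G}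
    (h : ∀ k, f (gen e k) = g (gen e k)) : f = g :=
  CoprodI.ext_hom _ _ fun k => cyclic_hom_ext (h k)

theorem aut_ext {f g : MulAut (CyclicFreeProd e)} (h : ∀ k, f (gen e k) = g (gen e k)) : f = g :=
  MulEquiv.toMonoidHom_injective (hom_ext h)

/-- The images of the generators under an Artin automorphism. -/
def artinFun {G : Type*} [Group G] (y : ℕ → G) (k j : ℕ) : G :=
  if j = k then y (k + 1) else if j = k + 1 then (y (k + 1))⁻¹ * y k * y (k + 1) else y j

/-- The images of the generators under the inverse of an Artin automorphism. -/
def artinInvFun {G : Type*} [Group G] (y : ℕ → G) (k j : ℕ) : G :=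
  if j = k + 1 then y k else if j = k then y k * y (k + 1) * (y k)⁻¹ else y j

theorem artinFun_pow {G : Type*} [Group G] {y : ℕ → G} (h : ∀ k, y k ^ e = 1) (k j : ℕ) :
    artinFun y k j ^ e = 1 := by
  have := conj_pow (i := e) (a := (y (k + 1))⁻¹) (b := y k)
  rw [inv_inv] at this
  unfold artinFun
  split_ifs
  · exact h _
  · rw [this, h]; simp
  · exact h _

theorem artinInvFun_pow {G : Type*} [Group G] {y : ℕ → G} (h : ∀ k, y k ^ e = 1) (k j : ℕ) :
    artinInvFun y k j ^ e = 1 := by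
  unfold artinInvFun
  split_ifs
  · exact h _
  · rw [conj_pow, h]; simp
  · exact h _

/-- The Artin automorphism `x_k ↦ x_{k+1}`, `x_{k+1} ↦ x_{k+1}⁻¹ x_k x_{k+1}`. -/
def artin (e k : ℕ) : MulAut (CyclicFreeProd e) :=
  MonoidHom.toMulEquiv (lift _ (artinFun_pow gen_pow k)) (lift _ (artinInvFun_pow gen_pow k))
    (hom_ext fun j => by
      by_cases h1 : j = k
      · subst h1; simp [artinFun, artinInvFun]
      by_cases h2 : j = k + 1
      · subst h2; simp [artinFun, artinInvFun]; group
      simp [artinFun, artinInvFun, h1, h2])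
    (hom_ext fun j => by
      by_cases h2 : j = k + 1
      · subst h2; simp [artinFun, artinInvFun]
      by_cases h1 : j = k
      · subst h1; simp [artinFun, artinInvFun]; group
      simp [artinFun, artinInvFun, h1, h2])

theorem artin_gen (k j : ℕ) : artin e k (gen e j) = artinFun (gen e) k j :=
  lift_gen _ (artinFun_pow gen_pow k) j

theorem artin_gen_self (k : ℕ) : artin e k (gen e k) = gen e (k + 1) := by
  simp [artin_gen, artinFun]

theorem artin_gen_succ (k : ℕ) : artin e k (gen e (k + 1)) =
    (gen e (k + 1))⁻¹ * gen e k * gen e (k + 1) := by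
  simp [artin_gen, artinFun]

theorem artin_gen_of_ne {k j : ℕ} (h1 : j ≠ k) (h2 : j ≠ k + 1) :
    artin e k (gen e j) = gen e j := by
  simp [artin_gen, artinFun, h1, h2]

theorem artin_comm {i j : ℕ} (h : i + 1 < j) : Commute (artin e i) (artin e j) := by
  refine aut_ext fun k => ?_
  simp only [MulAut.mul_apply]
  by_cases h1 : k = i
  · subst h1
    rw [artin_gen_of_ne (k := j) (by omega) (by omega), artin_gen_self,
      artin_gen_of_ne (by omega) (by omega)]
  by_cases h2 : k = i + 1
  · subst h2
    simp only [artin_gen_of_ne (show i + 1 ≠ j by omega) (show i + 1 ≠ j + 1 by omega),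
      artin_gen_of_ne (show i ≠ j by omega) (show i ≠ j + 1 by omega), artin_gen_succ,
      map_mul, map_inv]
  by_cases h3 : k = j
  · subst h3
    rw [artin_gen_of_ne (k := i) h1 h2, artin_gen_self, artin_gen_of_ne (by omega) (by omega)]
  by_cases h4 : k = j + 1
  · subst h4
    simp only [artin_gen_of_ne (show j + 1 ≠ i by omega) (show j + 1 ≠ i + 1 by omega),
      artin_gen_of_ne (show j ≠ i by omega) (show j ≠ i + 1 by omega), artin_gen_succ,
      map_mul, map_inv]
  rw [artin_gen_of_ne (k := j) h3 h4, artin_gen_of_ne h1 h2, artin_gen_of_ne h3 h4]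

theorem artin_braid (i : ℕ) :
    artin e i * artin e (i + 1) * artin e i = artin e (i + 1) * artin e i * artin e (i + 1) := by
  have a1 := artin_gen_self (e := e) i
  have a2 := artin_gen_succ (e := e) i
  have a3 := artin_gen_of_ne (e := e) (show i + 1 + 1 ≠ i by omega) (by omega)
  have b1 := artin_gen_of_ne (e := e) (show i ≠ i + 1 by omega) (by omega)
  have b2 := artin_gen_self (e := e) (i + 1)
  have b3 := artin_gen_succ (e := e) (i + 1)
  refine aut_ext fun k => ?_
  simp only [MulAut.mul_apply]
  by_cases h1 : k = i
  · subst h1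
    rw [a1, b1, b2, a1, b2, a3]
  by_cases h2 : k = i + 1
  · subst h2
    simp only [a1, a2, a3, b1, b2, b3, map_mul, map_inv]
  by_cases h3 : k = i + 1 + 1
  · subst h3
    simp only [a2, a3, b1, b2, b3, map_mul, map_inv]
    group
  simp only [artin_gen_of_ne (k := i + 1) (j := k) (by omega) (by omega), artin_gen_of_ne h1 h2]

/-- The holomorph of the free product. -/
abbrev Holomorph (e : ℕ) : Type :=
  SemidirectProduct (CyclicFreeProd e) (MulAut (CyclicFreeProd e)) (MonoidHom.id _)

/-- The automorphisms with i ≥ 1 fix the generator x₀, and the length-four relation amounts to x₁ ·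
(x₁⁻¹ x₀ x₁) = x₀ x₁. -/
theorem isTypeB_holomorph (e n : ℕ) : IsTypeB n
    (SemidirectProduct.inl (gen e 0) : Holomorph e)
    fun i => SemidirectProduct.inr (artin e i) where
  braid i _ := by simp only [← map_mul, artin_braid]
  comm i j h _ := (artin_comm h).map _
  comm_x i h _ := by
    refine SemidirectProduct.ext ?_ ?_
    · simp [artin_gen_of_ne (show 0 ≠ i by omega) (show 0 ≠ i + 1 by omega)]
    · simp
  sq _ := by
    have a1 := artin_gen_self (e := e) 0
    have a2 := artin_gen_succ (e := e) 0
    rw [zero_add] at a1 a2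
    refine SemidirectProduct.ext ?_ ?_
    · simp [a1, a2, mul_assoc]
    · simp

theorem conjSeq_holomorph (e k : ℕ) : conjSeq (SemidirectProduct.inl (gen e 0) : Holomorph e)
    (fun i => SemidirectProduct.inr (artin e i)) k = SemidirectProduct.inl (gen e k) := by
  induction k with
  | zero => rfl
  | succ k ih =>
    rw [conjSeq, ih, ← map_inv, ← SemidirectProduct.inl_aut, MonoidHom.id_apply, artin_gen_self]

/-- Projecting onto the factor 0 kills the generators of all other factors but not x₀. -/
theorem not_isConj_gen (he : 2 ≤ e) {k : ℕ} {p : CyclicFreeProd e}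
    (h : p * gen e k * p⁻¹ = gen e 0) : k = 0 := by
  by_contra hk
  have := congrArg (CoprodI.lift (Pi.mulSingle 0 (MonoidHom.id (Multiplicative (ZMod e))))) h
  simp [gen, Pi.mulSingle_eq_of_ne hk] at this
  exact cyclicGen_ne_one he this.symm

theorem eq_zpow_of_commute_gen (he : 2 ≤ e) {p : CyclicFreeProd e} {k : ℕ}
    (h : Commute (gen e k) p) : ∃ a : ℤ, p = gen e k ^ a := by
  obtain ⟨c, rfl⟩ := mem_range_of_commute (cyclicGen_ne_one he) h
  obtain ⟨a, rfl⟩ := exists_zpow_cyclicGen c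
  exact ⟨a, map_zpow _ _ _⟩

end CyclicFreeProd

end FreeProduct

/-! ### The circle of generators and the dihedral relation -/

section Circle

variable {G : Type*} [Group G]

theorem map_altProd {H : Type*} [Group H] (f : G →* H) (a b : G) (n : ℕ) :
    f (altProd a b n) = altProd (f a) (f b) n := by
  induction n generalizing a b with
  | zero => simp [altProd]
  | succ n ih => simp [altProd, ih]

/-- The sequence `c₀ = a`, `c₁ = b`, `c_{n+2} = c_{n+1} c_n c_{n+1}⁻¹`. -/
def circSeq (a b : G) : ℕ → G
  | 0 => a
  | 1 => b
  | n + 2 => circSeq a b (n + 1) * circSeq a b n * (circSeq a b (n + 1))⁻¹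

theorem circSeq_mul (a b : G) (n : ℕ) : circSeq a b (n + 1) * circSeq a b n = b * a := by
  induction n with
  | zero => rfl
  | succ n ih => rw [circSeq, inv_mul_cancel_right, ih]

theorem circSeq_succ (a b : G) (n : ℕ) : circSeq a b (n + 1) = b * a * (circSeq a b n)⁻¹ := by
  rw [← circSeq_mul a b n, mul_inv_cancel_right]

theorem circSeq_shift (a b : G) (n : ℕ) : circSeq b (b * a * b⁻¹) n = circSeq a b (n + 1) := by
  induction n with
  | zero => rfl
  | succ n ih => rw [circSeq_succ, ih, circSeq_succ a b (n + 1), inv_mul_cancel_right]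

theorem map_circSeq {H : Type*} [Group H] (f : G →* H) (a b : G) (n : ℕ) :
    f (circSeq a b n) = circSeq (f a) (f b) n := by
  induction n with
  | zero => rfl
  | succ n ih => simp [circSeq_succ, ih]

/-- Since x commutes with the constant product c_{n+1} c_n = x⁻¹ a x a, the circle is the orbit of a
under conjugation by x. If x^e = 1, it therefore has period e. -/
theorem circSeq_conj {a x : G} (h : Commute x (x⁻¹ * a * x * a)) (n : ℕ) :
    circSeq a (x⁻¹ * a * x) n = (x ^ n)⁻¹ * a * x ^ n := by
  induction n with
  | zero => simp [circSeq]
  | succ n ih =>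
    have := (h.pow_left n).eq
    rw [circSeq_succ, ih]
    calc _ = x⁻¹ * a * x * a * (x ^ n)⁻¹ * a⁻¹ * x ^ n := by group
      _ = (x ^ n)⁻¹ * (x ^ n * (x⁻¹ * a * x * a)) * (x ^ n)⁻¹ * a⁻¹ * x ^ n := by group
      _ = _ := by rw [this]; group

theorem altProd_succ_eq (a b : G) (n : ℕ) :
    altProd b a (n + 1) = circSeq a b (n + 1) * altProd b a n := by
  induction n using Nat.twoStepInduction with
  | zero => rfl
  | one => simp [altProd, circSeq]
  | more n ih _ =>
    rw [show altProd b a (n + 1 + 1 + 1) = b * a * altProd b a (n + 1) by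
      simp [altProd, mul_assoc], ih, show altProd b a (n + 1 + 1) = b * a * altProd b a n by
      simp [altProd, mul_assoc], ← mul_assoc, ← mul_assoc]
    congr 1
    calc _ = circSeq a b (n + 1 + 1 + 1) * circSeq a b (n + 1 + 1) * circSeq a b (n + 1) := by
          rw [circSeq_mul]
      _ = _ := by rw [mul_assoc, circSeq_mul]

/-- Both alternating words end in the same e - 1 letters, up to which they are c_e and c₀ = a: the
relation of length e says that the circle closes up. -/
theorem altProd_eq_iff (a b : G) {e : ℕ} (he : e ≠ 0) :
    altProd b a e = altProd a b e ↔ circSeq a b e = a := by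
  obtain ⟨m, rfl⟩ := Nat.exists_eq_succ_of_ne_zero he
  rw [altProd_succ_eq, altProd]
  exact mul_left_inj _

end Circle

/-! ### Homomorphisms from B(e,e,r) built from type B elements with x^e = 1 -/

section Lift

variable {e r : ℕ} {G : Type*} [Group G]

theorem Rel.lift_eq_one {f : Gen r → G}
    (h : ∀ x y, Rel e r x y → FreeGroup.lift f x = FreeGroup.lift f y) :
    ∀ w ∈ {w : FreeGroup (Gen r) | ∃ x y, Rel e r x y ∧ w = x * y⁻¹}, FreeGroup.lift f w = 1 := by
  rintro _ ⟨x, y, hxy, rfl⟩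
  rw [map_mul, map_inv, h x y hxy, mul_inv_cancel]

theorem Rel.mk_eq {x y : FreeGroup (Gen r)} (h : Rel e r x y) :
    (PresentedGroup.mk _ x : BraidGroup e r) = PresentedGroup.mk _ y :=
  PresentedGroup.mk_eq_mk_of_mul_inv_mem ⟨x, y, h, rfl⟩

/-- The images of the generators of `B(e,e,r)` in a group of type `B_r` with torsion. -/
def typeBFun (x : G) (σ : ℕ → G) : Gen r → G
  | .t i => if i = 0 then σ 0 else x⁻¹ * σ 0 * x
  | .s j => σ (j - 2)

variable {x : G} {σ : ℕ → G}

theorem IsTypeB.delta_comm {n : ℕ} (h : IsTypeB n x σ) (hn : 0 < n) :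
    Commute x (x⁻¹ * σ 0 * x * σ 0) := by
  have := h.sq hn
  show _ = _
  calc _ = x⁻¹ * (x * σ 0 * x * σ 0) := by group
    _ = _ := by rw [this]; group

/-- With a = σ₀, b = σ₁ and J = a x a, the bases of the two squares are x⁻¹ (b J) and x⁻¹ (J b), and
x commutes with both b and J. What remains is (b J)² = (J b)², that is, J commutes with b J b; this
holds because a and x do. -/
theorem IsTypeB.stt {n : ℕ} (h : IsTypeB n x σ) (hn : 1 < n) :
    (σ 1 * (x⁻¹ * σ 0 * x) * σ 0) ^ 2 = ((x⁻¹ * σ 0 * x) * σ 0 * σ 1) ^ 2 := by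
  have hb := h.braid 0 hn
  have hc := h.comm_x 1 le_rfl hn
  have hd := h.delta_comm (by omega)
  have hs := h.sq (by omega)
  rw [zero_add] at hb
  generalize σ 0 = a at *
  generalize σ 1 = b at *
  have hJ : Commute (a * x * a) x := by
    show _ = _
    rw [← hs]; group
  have key : Commute (a * x * a) (b * (a * x * a) * b) := by
    have h1 : Commute a (b * (a * x * a) * b) := by
      show _ = _
      calc _ = (a * b * a) * x * a * b := by group
        _ = b * a * (b * x) * a * b := by rw [hb]; group
        _ = b * a * x * (b * a * b) := by rw [← hc.eq]; group
        _ = _ := by rw [← hb]; group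
    have h2 : Commute x (b * (a * x * a) * b) :=
      (hc.mul_right hJ.symm).mul_right hc
    exact (h1.mul_left h2).mul_left h1
  have e1 : b * (x⁻¹ * a * x) * a = x⁻¹ * (b * (a * x * a)) := by
    have := hc.inv_left.eq
    calc _ = (b * x⁻¹) * a * x * a := by group
      _ = _ := by rw [← this]; group
  have e2 : (x⁻¹ * a * x) * a * b = x⁻¹ * (a * x * a * b) := by group
  have c1 : Commute x (b * (a * x * a)) := hc.mul_right hJ.symm
  have c2 : Commute x (a * x * a * b) := hJ.symm.mul_right hc
  rw [e1, e2, c1.inv_left.mul_pow, c2.inv_left.mul_pow]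
  congr 1
  have := key.eq
  calc _ = b * (a * x * a) * b * (a * x * a) := by rw [pow_two]; group
    _ = _ := by rw [← this, pow_two]; group

/-- The homomorphism from `B(e,e,r)` with `t₀ ↦ σ₀`, `t₁ ↦ x⁻¹ σ₀ x` and `s_j ↦ σ_{j-2}`. -/
def IsTypeB.braidLift (h : IsTypeB (r - 1) x σ) (hx : x ^ e = 1) (he : e ≠ 0) (hr : 2 ≤ r) :
    BraidGroup e r →* G :=
  PresentedGroup.toGroup (f := typeBFun x σ) <| Rel.lift_eq_one <| by
    intro a b hab
    induction hab with
    | ss_braid i j hij =>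
      have h1 : (j : ℕ) - 2 = (i : ℕ) - 2 + 1 := by have := i.2.1; omega
      have := j.2.2
      simpa [fs, typeBFun, h1] using h.braid (i - 2) (by omega)
    | ss_comm i j hij =>
      have := i.2.1; have := j.2.2
      simpa [fs, typeBFun] using (h.comm (i - 2) (j - 2) (by omega) (by omega)).eq
    -- The only place where x^e = 1 enters: conjugating σ₀ by x^e closes the circle.
    | tt =>
      have hc := circSeq_conj (h.delta_comm (by omega)) e
      rw [hx] at hc
      rw [map_altProd, map_altProd]
      simpa [ft, typeBFun] using (altProd_eq_iff _ _ he).mpr (by simpa using hc)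
    | st_braid j hj i =>
      have := j.2.2
      have hb := h.braid 0 (by omega)
      have hc := h.comm_x 1 le_rfl (by omega)
      rw [zero_add] at hb
      have h0 : (j : ℕ) - 2 = 1 := by omega
      simp only [fs, ft, typeBFun, map_mul, FreeGroup.lift_apply_of, h0]
      split_ifs
      · exact hb.symm
      · have h1 : σ 1 = x⁻¹ * σ 1 * x := by rw [mul_assoc, ← hc.eq]; group
        rw [h1]
        calc _ = x⁻¹ * (σ 1 * σ 0 * σ 1) * x := by group
          _ = _ := by rw [← hb]; group
    | st_comm j hj i =>
      have := j.2.2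
      have h1 : Commute (σ (j - 2)) (σ 0) := (h.comm 0 (j - 2) (by omega) (by omega)).symm
      have h2 : Commute (σ (j - 2)) x := (h.comm_x (j - 2) (by omega) (by omega)).symm
      simp only [fs, ft, typeBFun, map_mul, FreeGroup.lift_apply_of]
      split_ifs
      · exact h1.eq
      · exact ((h2.inv_right.mul_right h1).mul_right h2).eq
    | stt j hj =>
      have := j.2.2
      have h0 : (j : ℕ) - 2 = 1 := by omega
      simpa [fs, ft, typeBFun, h0] using h.stt (by omega)

section

variable (h : IsTypeB (r - 1) x σ) (hx : x ^ e = 1) (he : e ≠ 0) (hr : 2 ≤ r)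

theorem IsTypeB.braidLift_t_zero : h.braidLift hx he hr (.of (.t 0)) = σ 0 :=
  PresentedGroup.toGroup.of _

theorem IsTypeB.braidLift_t_one : h.braidLift hx he hr (.of (.t 1)) = x⁻¹ * σ 0 * x :=
  PresentedGroup.toGroup.of _

theorem IsTypeB.braidLift_s (j : Set.Icc 3 r) : h.braidLift hx he hr (s e j) = σ (j - 2) :=
  PresentedGroup.toGroup.of _

end

end Lift

/-! ### The rotation automorphism -/

section Down

variable {e r : ℕ}

theorem circle_eq_circSeq (e r n : ℕ) : circle e r n = circSeq (circle e r 0) (circle e r 1) n := by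
  induction n using Nat.twoStepInduction with
  | zero => rfl
  | one => rfl
  | more n h1 h2 => rw [circSeq, ← h1, ← h2]; rfl

theorem circle_self (he : e ≠ 0) : circle e r e = circle e r 0 := by
  rw [circle_eq_circSeq]
  refine (altProd_eq_iff _ _ he).mp ?_
  have := Rel.mk_eq (Rel.tt (e := e) (r := r))
  rwa [map_altProd, map_altProd] at this

theorem circle_succ (n : ℕ) :
    circle e r (n + 1) = circle e r 1 * circle e r 0 * (circle e r n)⁻¹ := by
  rw [circle_eq_circSeq e r (n + 1), circSeq_succ, ← circle_eq_circSeq]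

theorem circle_add_self (he : e ≠ 0) (n : ℕ) : circle e r (n + e) = circle e r n := by
  induction n with
  | zero => rw [zero_add, circle_self he]
  | succ n ih => rw [Nat.succ_add, circle_succ, ih, ← circle_succ]

theorem t_natCast (he : e ≠ 0) (n : ℕ) : t e r n = circle e r n := by
  rw [t, ZMod.val_natCast]
  have (k m : ℕ) : circle e r (m + e * k) = circle e r m := by
    induction k with
    | zero => rfl
    | succ k ih => rw [Nat.mul_succ, ← add_assoc, circle_add_self he, ih]
  conv_rhs => rw [← Nat.mod_add_div n e, this]

/-- The images of the generators under the rotation `t_i ↦ t_{i+1}`. -/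
def upFun (e r : ℕ) : Gen r → BraidGroup e r
  | .t i => if i = 0 then circle e r 1 else circle e r 2
  | .s j => s e j

/-- With u = s₃, a = t₀, b = t₁, this is the braid relation between s₃ and t₂, needed for the
rotation to respect the relation between s₃ and t₁; it is where the squared relation is used. -/
theorem braid_of_sq {G : Type*} [Group G] {u a b : G} (ha : u * a * u = a * u * a)
    (hb : u * b * u = b * u * b) (h : (u * b * a) ^ 2 = (b * a * u) ^ 2) :
    u * (b * a * b⁻¹) * u = b * a * b⁻¹ * u * (b * a * b⁻¹) := by
  have h1 : b⁻¹ * u = u * b * u⁻¹ * b⁻¹ := by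
    calc b⁻¹ * u = b⁻¹ * (u * b * u) * u⁻¹ * b⁻¹ := by group
      _ = _ := by rw [hb]; group
  have h2 : u⁻¹ * a = a * u * a⁻¹ * u⁻¹ := by
    calc u⁻¹ * a = u⁻¹ * (a * u * a) * a⁻¹ * u⁻¹ * (u * a * u * u⁻¹ * a⁻¹ * u⁻¹) := by group
      _ = u⁻¹ * (u * a * u) * a⁻¹ * u⁻¹ := by rw [← ha]; group
      _ = _ := by group
  calc u * (b * a * b⁻¹) * u = u * b * a * (b⁻¹ * u) := by group
    _ = (u * b * a) * u * b * a * a⁻¹ * u⁻¹ * b⁻¹ := by rw [h1]; group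
    _ = (u * b * a) ^ 2 * a⁻¹ * u⁻¹ * b⁻¹ := by rw [pow_two]; group
    _ = b * a * u * b * (a * u * a⁻¹ * u⁻¹) * b⁻¹ := by rw [h, pow_two]; group
    _ = b * a * (u * b * u⁻¹ * b⁻¹) * b * a * b⁻¹ := by rw [← h2]; group
    _ = _ := by rw [← h1]; group

/-- The rotation `t_i ↦ t_{i+1}` of `B(e,e,r)`. -/
def up (r : ℕ) (he : e ≠ 0) : Monoid.End (BraidGroup e r) :=
  PresentedGroup.toGroup (f := upFun e r) <| Rel.lift_eq_one <| by
    intro a b hab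
    induction hab with
    | ss_braid i j hij =>
      simp only [fs, upFun, map_mul, FreeGroup.lift_apply_of]
      exact Rel.mk_eq (.ss_braid i j hij)
    | ss_comm i j hij =>
      simp only [fs, upFun, map_mul, FreeGroup.lift_apply_of]
      exact Rel.mk_eq (.ss_comm i j hij)
    | tt =>
      rw [map_altProd, map_altProd]
      refine (altProd_eq_iff _ _ he).mpr ?_
      have := circSeq_shift (circle e r 0) (circle e r 1) e
      rw [← circle_eq_circSeq, Nat.add_comm, circle_add_self he] at this
      simp only [ft, upFun, FreeGroup.lift_apply_of, one_ne_zero, if_true, if_false]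
      exact this
    | st_braid j hj i =>
      simp only [fs, ft, upFun, map_mul, FreeGroup.lift_apply_of]
      split_ifs
      · exact Rel.mk_eq (.st_braid j hj 1)
      · have h0 := Rel.mk_eq (.st_braid (e := e) j hj 0)
        have h1 := Rel.mk_eq (.st_braid (e := e) j hj 1)
        have h2 := Rel.mk_eq (.stt (e := e) j hj)
        simp only [map_mul, map_pow] at h0 h1 h2
        exact braid_of_sq h0 h1 h2
    | st_comm j hj i =>
      have h0 : Commute (s e j) (circle e r 0) := by
        exact Rel.mk_eq (.st_comm (e := e) j hj 0)
      have h1 : Commute (s e j) (circle e r 1) := by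
        exact Rel.mk_eq (.st_comm (e := e) j hj 1)
      simp only [fs, ft, upFun, map_mul, FreeGroup.lift_apply_of]
      split_ifs
      · exact h1.eq
      · exact ((h1.mul_right h0).mul_right h1.inv_right).eq
    | stt j hj =>
      -- The rotation fixes t₁t₀, so the squared relation goes to itself.
      have h1 : circle e r 2 * circle e r 1 = circle e r 1 * circle e r 0 := by
        rw [circle_succ 1, inv_mul_cancel_right]
      simp only [fs, ft, upFun, map_mul, map_pow, FreeGroup.lift_apply_of, one_ne_zero, if_true,
        if_false]
      rw [mul_assoc (s e j), h1, ← mul_assoc]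
      exact Rel.mk_eq (.stt (e := e) j hj)

theorem up_s (he : e ≠ 0) (j : Set.Icc 3 r) : up r he (s e j) = s e j :=
  PresentedGroup.toGroup.of _

theorem up_circle (he : e ≠ 0) (n : ℕ) : up r he (circle e r n) = circle e r (n + 1) := by
  have h0 : up r he (circle e r 0) = circle e r 1 := PresentedGroup.toGroup.of _
  have h1 : up r he (circle e r 1) = circle e r 2 := PresentedGroup.toGroup.of _
  rw [circle_eq_circSeq]
  refine (map_circSeq (up r he : BraidGroup e r →* BraidGroup e r) _ _ _).trans ?_
  refine (congrArg₂ (fun a b => circSeq a b n) h0 h1).trans ?_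
  rw [circle_eq_circSeq e r (n + 1), ← circSeq_shift]
  rfl

theorem up_pow_circle (he : e ≠ 0) (n k : ℕ) :
    (up r he ^ k) (circle e r n) = circle e r (n + k) := by
  induction k with
  | zero => rfl
  | succ k ih =>
    rw [pow_succ']
    show up r he ((up r he ^ k) (circle e r n)) = _
    rw [ih, up_circle, add_assoc]

theorem up_pow_s (he : e ≠ 0) (j : Set.Icc 3 r) (k : ℕ) :
    (up r he ^ k) (s e j) = s e j := by
  induction k with
  | zero => rfl
  | succ k ih =>
    rw [pow_succ']
    show up r he ((up r he ^ k) (s e j)) = _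
    rw [ih, up_s]

theorem braidGroup_hom_ext {G : Type*} [Group G] {f g : BraidGroup e r →* G}
    (h0 : f (circle e r 0) = g (circle e r 0)) (h1 : f (circle e r 1) = g (circle e r 1))
    (hs : ∀ j, f (s e j) = g (s e j)) : f = g := by
  refine PresentedGroup.ext fun x => ?_
  match x with
  | .t 0 => exact h0
  | .t 1 => exact h1
  | .s j => exact hs j

theorem up_pow_self (he : e ≠ 0) : (up r he) ^ e = 1 := by
  refine braidGroup_hom_ext ?_ ?_ fun j => ?_
  · exact (up_pow_circle he 0 e).trans (circle_add_self he 0)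
  · exact (up_pow_circle he 1 e).trans (circle_add_self he 1)
  · exact up_pow_s he j e

/-- The automorphism `t_i ↦ t_{i-1}` of `B(e,e,r)`. -/
def down (r : ℕ) (he : e ≠ 0) : MulAut (BraidGroup e r) :=
  -- The e-th power of the rotation is trivial, so its power e - 1 is its inverse.
  MonoidHom.toMulEquiv (up r he ^ (e - 1)) (up r he)
    ((pow_succ' (up r he) (e - 1)).symm.trans <| by
      rw [Nat.sub_add_cancel (Nat.pos_of_ne_zero he)]; exact up_pow_self he)
    ((pow_succ (up r he) (e - 1)).symm.trans <| by
      rw [Nat.sub_add_cancel (Nat.pos_of_ne_zero he)]; exact up_pow_self he)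

theorem down_symm_apply (he : e ≠ 0) (b : BraidGroup e r) : (down r he).symm b = up r he b := rfl

theorem down_s (he : e ≠ 0) (j : Set.Icc 3 r) : down r he (s e j) = s e j := up_pow_s he j _

theorem down_circle_succ (he : e ≠ 0) (n : ℕ) :
    down r he (circle e r (n + 1)) = circle e r n := by
  rw [← MulEquiv.eq_symm_apply, down_symm_apply, up_circle]

theorem down_t (he : e ≠ 0) (i : ZMod e) : down r he (t e r i) = t e r (i - 1) := by
  have : NeZero e := ⟨he⟩
  obtain ⟨n, hn⟩ := ZMod.natCast_zmod_surjective (i - 1)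
  obtain rfl : i = ((n + 1 : ℕ) : ZMod e) := by rw [Nat.cast_succ, hn]; ring
  rw [← hn, t_natCast he, t_natCast he, down_circle_succ]

theorem down_pow_self (he : e ≠ 0) : down r he ^ e = 1 := by
  rw [← inv_inj, inv_one, ← inv_pow]
  refine MulEquiv.ext fun b => ?_
  have (k : ℕ) : ((down r he)⁻¹ ^ k) b = (up r he ^ k) b := by
    induction k with
    | zero => rfl
    | succ k ih => rw [pow_succ', pow_succ', MulAut.mul_apply, ih]; rfl
  rw [this, up_pow_self]; rfl

end Down

/-! ### The action of the braid group induced from type B -/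

section Induced

variable {A : Type*} [Group A]

/-- The cocycle of the induced action: the element by which the generator `σ_i` of the braid group
on `m + 2` strands acts on the coset of its pure-on-one-strand subgroup labelled by `k`. -/
def inducedCocycle (m : ℕ) (x : A) (σ : ℕ → A) (i k : ℕ) : A :=
  -- The true coset labels are 0, …, m + 1; larger ones are padding on which everything acts
  -- trivially.
  if m + 1 < k then 1
  else if k < i then σ (i - 1)
  else if k = i then 1
  else if k = i + 1 then conjSeq x σ i
  else σ i

/-- The permutation of `ℕ × A` by which the generator `σ_i` acts in the induced action. -/
def induced (m : ℕ) (x : A) (σ : ℕ → A) (i : ℕ) : Equiv.Perm (ℕ × A) where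
  toFun p := (Equiv.swap i (i + 1) p.1, inducedCocycle m x σ i p.1 * p.2)
  invFun p := (Equiv.swap i (i + 1) p.1,
    (inducedCocycle m x σ i (Equiv.swap i (i + 1) p.1))⁻¹ * p.2)
  left_inv p := by simp
  right_inv p := by simp

variable {m : ℕ} {x : A} {σ : ℕ → A}

theorem induced_lt {i k : ℕ} (hi : i ≤ m) (h : k < i) (g : A) :
    induced m x σ i (k, g) = (k, σ (i - 1) * g) := by
  simp [induced, inducedCocycle, h, show ¬ m + 1 < k by omega,
    Equiv.swap_apply_of_ne_of_ne (show k ≠ i by omega) (show k ≠ i + 1 by omega)]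

theorem induced_self {i : ℕ} (hi : i ≤ m) (g : A) : induced m x σ i (i, g) = (i + 1, g) := by
  simp [induced, inducedCocycle, show ¬ m + 1 < i by omega]

theorem induced_succ {i : ℕ} (hi : i ≤ m) (g : A) :
    induced m x σ i (i + 1, g) = (i, conjSeq x σ i * g) := by
  simp [induced, inducedCocycle, show ¬ m < i by omega]

theorem induced_gt {i k : ℕ} (hk : k ≤ m + 1) (h : i + 1 < k) (g : A) :
    induced m x σ i (k, g) = (k, σ i * g) := by
  simp [induced, inducedCocycle, show ¬ m + 1 < k by omega, show ¬ k < i by omega,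
    show k ≠ i by omega, show k ≠ i + 1 by omega,
    Equiv.swap_apply_of_ne_of_ne (show k ≠ i by omega) (show k ≠ i + 1 by omega)]

theorem induced_top {i k : ℕ} (hi : i ≤ m) (h : m + 1 < k) (g : A) :
    induced m x σ i (k, g) = (k, g) := by
  simp [induced, inducedCocycle, h,
    Equiv.swap_apply_of_ne_of_ne (show k ≠ i by omega) (show k ≠ i + 1 by omega)]

/-- The induced action satisfies the braid relations. -/
theorem IsTypeB.induced (h : IsTypeB m x σ) : IsTypeB (m + 1) 1 (induced m x σ) where
  braid i hi := by
    refine Equiv.ext fun ⟨k, g⟩ => ?_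
    have a1 (g : A) := induced_self (x := x) (σ := σ) (show i ≤ m by omega) g
    have a2 (g : A) := induced_succ (x := x) (σ := σ) (show i ≤ m by omega) g
    have a3 (g : A) := induced_gt (x := x) (σ := σ) (show i + 1 + 1 ≤ m + 1 by omega)
      (show i + 1 < i + 1 + 1 by omega) g
    have b1 (g : A) := induced_lt (x := x) (σ := σ) (show i + 1 ≤ m by omega)
      (show i < i + 1 by omega) g
    have b2 (g : A) := induced_self (x := x) (σ := σ) (show i + 1 ≤ m by omega) g
    have b3 (g : A) := induced_succ (x := x) (σ := σ) (show i + 1 ≤ m by omega) g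
    rw [Nat.add_sub_cancel] at b1
    simp only [Equiv.Perm.mul_apply]
    rcases lt_or_ge (m + 1) k with h0 | h0
    · simp only [induced_top (show i ≤ m by omega) h0,
        induced_top (show i + 1 ≤ m by omega) h0]
    rcases lt_or_ge k i with h1 | h1
    · simp only [induced_lt (show i ≤ m by omega) h1,
        induced_lt (show i + 1 ≤ m by omega) (show k < i + 1 by omega), Nat.add_sub_cancel,
        ← mul_assoc]
      have := h.braid (i - 1) (by omega)
      rw [Nat.sub_add_cancel (by omega)] at this
      rw [this]
    rcases h1.eq_or_lt with rfl | h1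
    · rw [a1, b2, a3, b1, a1, b2]
    rcases Nat.eq_or_lt_of_le h1 with rfl | h1
    · rw [a2, b1, a1, b2, a3, b3, conjSeq]
      congr 1; group
    -- On the label i + 2, both sides end at label i, and comparing their translations gives exactly
    -- the length-four relation between x_i and σ_i.
    rcases Nat.eq_or_lt_of_le h1 with rfl | h1
    · rw [a3, b3, a2, b3, a2, b1]
      have := h.conjSeq_sq (k := i) (by omega)
      congr 1
      rw [conjSeq]
      calc _ = conjSeq x σ i * σ i * conjSeq x σ i * g := by group
        _ = (conjSeq x σ i * σ i * conjSeq x σ i * σ i) * (σ i)⁻¹ * g := by group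
        _ = _ := by rw [this]; group
    · simp only [induced_gt h0 (show i + 1 < k by omega),
        induced_gt h0 (show i + 1 + 1 < k by omega), ← mul_assoc]
      rw [h.braid i (by omega)]
  comm i j hij hj := by
    refine Equiv.ext fun ⟨k, g⟩ => ?_
    have hi' : i ≤ m := by omega
    have hj' : j ≤ m := by omega
    simp only [Equiv.Perm.mul_apply]
    rcases lt_or_ge (m + 1) k with h0 | h0
    · simp only [induced_top hi' h0, induced_top hj' h0]
    rcases lt_or_ge k i with h1 | h1
    · simp only [induced_lt hi' h1, induced_lt hj' (show k < j by omega), ← mul_assoc]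
      rw [(h.comm (i - 1) (j - 1) (by omega) (by omega)).eq]
    rcases h1.eq_or_lt with rfl | h1
    · rw [induced_lt hj' (by omega), induced_self hi', induced_self hi',
        induced_lt hj' (by omega)]
    rcases Nat.eq_or_lt_of_le h1 with rfl | h1
    · rw [induced_lt hj' (by omega), induced_succ hi', induced_succ hi',
        induced_lt hj' (by omega), ← mul_assoc, ← mul_assoc,
        (h.conjSeq_comm_of_lt (show i < j - 1 by omega) (by omega)).eq]
    rcases lt_or_ge k j with h2 | h2
    · simp only [induced_gt h0 (show i + 1 < k by omega), induced_lt hj' h2, ← mul_assoc]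
      rw [(h.comm i (j - 1) (by omega) (by omega)).eq]
    rcases h2.eq_or_lt with rfl | h2
    · rw [induced_self hj', induced_gt h0 hij, induced_self hj',
        induced_gt (by omega) (by omega)]
    rcases Nat.eq_or_lt_of_le h2 with rfl | h2
    · rw [induced_succ hj', induced_gt (by omega) hij, induced_gt h0 (by omega),
        induced_succ hj', ← mul_assoc, ← mul_assoc,
        (h.conjSeq_comm_of_gt hij (by omega)).eq]
    · simp only [induced_gt h0 (show i + 1 < k by omega), induced_gt h0 (show j + 1 < k by omega),
        ← mul_assoc]
      rw [(h.comm i j hij (by omega)).eq]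
  -- With special generator 1, only the braid relations of type A have content.
  comm_x i _ _ := Commute.one_left _
  sq _ := by simp

end Induced

/-! ### The Artin group of type B_{r-1} and its universal property -/

section Artin

variable {r : ℕ} {G : Type*} [Group G]

/-- The images of the generators of the Artin group of type `B_{r-1}`. -/
def artinBFun (r : ℕ) (x : G) (σ : ℕ → G) (i : Fin (r - 1)) : G :=
  -- In `CoxeterMatrix.B` the special node comes last, so the numbering is reversed: σ_i is the node
  -- r - 3 - i.
  if (i : ℕ) = r - 2 then x else σ (r - 3 - i)

theorem CoxeterMatrix_B_apply {n : ℕ} (i j : Fin n) : CoxeterMatrix.B n i j =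
    if i = j then 1 else if (i : ℕ) = n - 1 ∧ (j : ℕ) = n - 2 ∨ (j : ℕ) = n - 1 ∧ (i : ℕ) = n - 2
    then 4 else if (j : ℕ) + 1 = i ∨ (i : ℕ) + 1 = j then 3 else 2 := rfl

/-- The homomorphism from the Artin group of type `B_{r-1}` given by elements satisfying its
relations. -/
def IsTypeB.artinLift {x : G} {σ : ℕ → G} (h : IsTypeB (r - 2) x σ) :
    ArtinGroup (CoxeterMatrix.B (r - 1)) →* G :=
  PresentedGroup.toGroup (f := artinBFun r x σ) <| by
    have key (i j : Fin (r - 1)) (hij : i < j) :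
        altProd (artinBFun r x σ i) (artinBFun r x σ j) (CoxeterMatrix.B (r - 1) i j) =
        altProd (artinBFun r x σ j) (artinBFun r x σ i) (CoxeterMatrix.B (r - 1) i j) := by
      have hj := j.2
      have hij' : (i : ℕ) < j := hij
      rw [CoxeterMatrix_B_apply, if_neg hij.ne]
      by_cases h1 : (j : ℕ) = r - 2
      · have hx : artinBFun r x σ j = x := if_pos h1
        have hs : artinBFun r x σ i = σ (r - 3 - i) := if_neg (by omega)
        rw [hx, hs]
        by_cases h2 : (i : ℕ) = r - 3
        · rw [if_pos (by omega)]
          have := h.sq (by omega)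
          simp only [altProd, mul_one, h2, Nat.sub_self, ← mul_assoc, this]
        · rw [if_neg (by omega), if_neg (by omega)]
          simpa [altProd] using (h.comm_x (r - 3 - i) (by omega) (by omega)).eq.symm
      · have hs : artinBFun r x σ i = σ (r - 3 - i) := if_neg (by omega)
        have hs' : artinBFun r x σ j = σ (r - 3 - j) := if_neg (by omega)
        rw [hs, hs', if_neg (by omega)]
        by_cases h2 : (i : ℕ) + 1 = j
        · rw [if_pos (by omega)]
          have := h.braid (r - 3 - j) (by omega)
          rw [show r - 3 - (j : ℕ) + 1 = r - 3 - i by omega] at this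
          simp only [altProd, mul_one, ← mul_assoc, this]
        · rw [if_neg (by omega)]
          simpa [altProd] using (h.comm (r - 3 - j) (r - 3 - i) (by omega) (by omega)).eq.symm
    rintro _ ⟨i, j, rfl⟩
    rw [map_mul, map_inv, map_altProd, map_altProd, FreeGroup.lift_apply_of,
      FreeGroup.lift_apply_of, mul_inv_eq_one]
    rcases lt_trichotomy i j with hij | rfl | hij
    · exact key i j hij
    · rfl
    · rw [CoxeterMatrix.symmetric]; exact (key j i hij).symm

theorem IsTypeB.artinLift_of {x : G} {σ : ℕ → G} (h : IsTypeB (r - 2) x σ) (i : Fin (r - 1)) :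
    h.artinLift (.of i) = artinBFun r x σ i :=
  PresentedGroup.toGroup.of _

/-- The special generator of the Artin group of type `B_{r-1}`. -/
def artinX (hr : 2 ≤ r) : ArtinGroup (CoxeterMatrix.B (r - 1)) := .of ⟨r - 2, by omega⟩

/-- The other generators of the Artin group of type `B_{r-1}`, starting from the neighbour of the
special one. -/
def artinS (r i : ℕ) : ArtinGroup (CoxeterMatrix.B (r - 1)) :=
  if h : i + 2 < r then .of ⟨r - 3 - i, by omega⟩ else 1

theorem artin_rel {B : Type*} (M : CoxeterMatrix B) (i j : B) :
    altProd (.of i : ArtinGroup M) (.of j) (M i j) = altProd (.of j) (.of i) (M i j) := by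
  have : (PresentedGroup.mk (artinRelators M)) (altProd (.of i) (.of j) (M i j)) =
      (PresentedGroup.mk (artinRelators M)) (altProd (.of j) (.of i) (M i j)) :=
    PresentedGroup.mk_eq_mk_of_mul_inv_mem ⟨i, j, rfl⟩
  rwa [map_altProd, map_altProd] at this

theorem isTypeB_artin (hr : 2 ≤ r) : IsTypeB (r - 2) (artinX hr) (artinS r) where
  braid i hi := by
    have := artin_rel (CoxeterMatrix.B (r - 1)) ⟨r - 3 - i, by omega⟩ ⟨r - 3 - (i + 1), by omega⟩
    rw [CoxeterMatrix_B_apply, if_neg (by simp only [Fin.mk.injEq]; omega),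
      if_neg (by dsimp only; omega), if_pos (by dsimp only; omega)] at this
    simpa [altProd, mul_assoc, artinS, show i + 2 < r by omega, show i + 1 + 2 < r by omega]
      using this
  comm i j hij hj := by
    have := artin_rel (CoxeterMatrix.B (r - 1)) ⟨r - 3 - i, by omega⟩ ⟨r - 3 - j, by omega⟩
    rw [CoxeterMatrix_B_apply, if_neg (by simp only [Fin.mk.injEq]; omega),
      if_neg (by dsimp only; omega), if_neg (by dsimp only; omega)] at this
    show _ = _
    simpa [altProd, mul_assoc, artinS, show i + 2 < r by omega, show j + 2 < r by omega]
      using this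
  comm_x i hi hi' := by
    have := artin_rel (CoxeterMatrix.B (r - 1)) ⟨r - 2, by omega⟩ ⟨r - 3 - i, by omega⟩
    rw [CoxeterMatrix_B_apply, if_neg (by simp only [Fin.mk.injEq]; omega),
      if_neg (by dsimp only; omega), if_neg (by dsimp only; omega)] at this
    show _ = _
    simpa [altProd, mul_assoc, artinX, artinS, show i + 2 < r by omega] using this
  sq h0 := by
    have := artin_rel (CoxeterMatrix.B (r - 1)) ⟨r - 2, by omega⟩ ⟨r - 3, by omega⟩
    rw [CoxeterMatrix_B_apply, if_neg (by simp only [Fin.mk.injEq]; omega),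
      if_pos (by dsimp only; omega)] at this
    simpa [altProd, mul_assoc, artinX, artinS, show 2 < r by omega] using this

theorem artin_closure (hr : 2 ≤ r) {H : Subgroup (ArtinGroup (CoxeterMatrix.B (r - 1)))}
    (hx : artinX hr ∈ H) (hs : ∀ i, i + 2 < r → artinS r i ∈ H) : H = ⊤ := by
  rw [eq_top_iff, ← PresentedGroup.closure_range_of, Subgroup.closure_le]
  rintro _ ⟨i, rfl⟩
  have hi := i.2
  by_cases h : (i : ℕ) = r - 2
  · have : artinX hr = .of i := congrArg _ (Fin.ext h.symm)
    exact this ▸ hx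
  · have h2 := hs (r - 3 - i) (by omega)
    rw [artinS, dif_pos (by omega)] at h2
    have : (⟨r - 3 - (r - 3 - i), by omega⟩ : Fin (r - 1)) = i := Fin.ext (by simp; omega)
    rwa [this] at h2

theorem IsTypeB.artinLift_X {x : G} {σ : ℕ → G} (h : IsTypeB (r - 2) x σ) (hr : 2 ≤ r) :
    h.artinLift (artinX hr) = x := by
  rw [artinX, h.artinLift_of, artinBFun, if_pos rfl]

theorem IsTypeB.artinLift_S {x : G} {σ : ℕ → G} (h : IsTypeB (r - 2) x σ) {i : ℕ}
    (hi : i + 2 < r) : h.artinLift (artinS r i) = σ i := by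
  rw [artinS, dif_pos hi, h.artinLift_of, artinBFun, if_neg (by simp; omega)]
  congr 1
  simp; omega

end Artin

/-! ### The Artin group inside B(e,e,r) -/

section Embedding

variable {e r : ℕ}

/-- The elements `s₃, s₄, …` of `B(e,e,r)`. -/
def sSeq (e r i : ℕ) : BraidGroup e r := if h : i + 3 ≤ r then s e ⟨i + 3, by simp, h⟩ else 1

theorem sSeq_of_le {i : ℕ} (h : i + 3 ≤ r) : sSeq e r i = s e ⟨i + 3, by simp, h⟩ := dif_pos h

/-- The element `t₁ t₀` of `B(e,e,r)`. -/
def delta (e r : ℕ) : BraidGroup e r := circle e r 1 * circle e r 0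

theorem sSeq_braid {i : ℕ} (hi : i + 4 ≤ r) :
    sSeq e r i * sSeq e r (i + 1) * sSeq e r i =
      sSeq e r (i + 1) * sSeq e r i * sSeq e r (i + 1) := by
  rw [sSeq_of_le (show i + 3 ≤ r by omega), sSeq_of_le (show i + 1 + 3 ≤ r by omega)]
  exact Rel.mk_eq (.ss_braid _ _ (by simp))

theorem sSeq_comm {i j : ℕ} (hij : i + 1 < j) (hj : j + 3 ≤ r) :
    Commute (sSeq e r i) (sSeq e r j) := by
  rw [sSeq_of_le (show i + 3 ≤ r by omega), sSeq_of_le hj]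
  exact Rel.mk_eq (.ss_comm _ _ (by simp; omega))

theorem circle_zero_comm {i : ℕ} (h1 : 1 ≤ i) (hi : i + 3 ≤ r) :
    Commute (circle e r 0) (sSeq e r i) := by
  rw [sSeq_of_le hi]
  exact (Rel.mk_eq (.st_comm _ (by simp; omega) 0)).symm

theorem circle_one_comm {i : ℕ} (h1 : 1 ≤ i) (hi : i + 3 ≤ r) :
    Commute (circle e r 1) (sSeq e r i) := by
  rw [sSeq_of_le hi]
  exact (Rel.mk_eq (.st_comm _ (by simp; omega) 1)).symm

/-- The length-four relation between t₁t₀ and s₃ is the squared defining relation of B(e,e,r). -/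
theorem isTypeB_delta (e r : ℕ) : IsTypeB (r - 2) (delta e r) (sSeq e r) where
  braid i hi := sSeq_braid (by omega)
  comm i j hij hj := sSeq_comm hij (by omega)
  comm_x i h1 hi := (circle_one_comm h1 (by omega)).mul_left (circle_zero_comm h1 (by omega))
  sq h0 := by
    have := Rel.mk_eq (.stt (e := e) (r := r) ⟨3, by simp; omega⟩ rfl)
    simp only [map_mul, pow_two, ← mul_assoc] at this
    rw [sSeq_of_le (by omega), delta]
    simp only [← mul_assoc]
    exact this.symm

/-- The Artin group of type `B_{r-1}` embeds in `B(e,e,r)`. -/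
theorem artinLift_injective (he : e ≠ 0) (hr : 2 ≤ r) :
    Function.Injective (isTypeB_delta e r).artinLift := by
  have hi := (isTypeB_artin hr).induced
  rw [show r - 2 + 1 = r - 1 by omega] at hi
  -- Taking x = 1 sends both t₀ and t₁ to σ₀, so this factors through the braid group on r strands.
  let Φ := hi.braidLift (e := e) (one_pow e) he hr
  let S : Subgroup (ArtinGroup (CoxeterMatrix.B (r - 1))) :=
    { carrier := {a | ∀ g, Φ ((isTypeB_delta e r).artinLift a) (0, g) = (0, a * g)}
      one_mem' := fun g => by simp
      mul_mem' := fun {a b} ha hb g => by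
        rw [map_mul, map_mul, Equiv.Perm.mul_apply, hb, ha, mul_assoc]
      inv_mem' := fun {a} ha g => by
        rw [map_inv, map_inv, Equiv.Perm.inv_eq_iff_eq, ha, mul_inv_cancel_left] }
  have hS : S = ⊤ := by
    refine artin_closure hr (fun g => ?_) fun i hi' g => ?_
    · rw [IsTypeB.artinLift_X, delta, map_mul]
      have h0 : Φ (circle e r 0) = induced (r - 2) (artinX hr) (artinS r) 0 :=
        hi.braidLift_t_zero _ _ _
      have h1 : Φ (circle e r 1) = induced (r - 2) (artinX hr) (artinS r) 0 := by
        refine (hi.braidLift_t_one _ _ _).trans ?_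
        simp
      -- δ acts as σ₀²: label 0 goes to 1 and back, picking up x₀ = x.
      rw [h0, h1, Equiv.Perm.mul_apply, induced_self (Nat.zero_le _), induced_succ (Nat.zero_le _)]
      rfl
    · rw [IsTypeB.artinLift_S _ hi', sSeq_of_le (by omega)]
      refine (congrArg (fun f : Equiv.Perm _ => f (0, g)) (hi.braidLift_s _ _ _ _)).trans ?_
      show induced (r - 2) (artinX hr) (artinS r) (i + 1) (0, g) = _
      rw [induced_lt (by omega) (by omega), Nat.add_sub_cancel]
  refine (injective_iff_map_eq_one _).mpr fun a ha => ?_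
  have : a ∈ S := hS ▸ Subgroup.mem_top a
  have := this 1
  rw [ha] at this
  simpa using this.symm

end Embedding

/-! ### The normal subgroup N and coset representatives -/

section Cosets

variable {G : Type*} [Group G] {n : ℕ} {x : G} {σ : ℕ → G}

/-- The subgroup generated by `x₀, …, x_n`. -/
def conjSubgroup (n : ℕ) (x : G) (σ : ℕ → G) : Subgroup G :=
  Subgroup.closure {y | ∃ k ≤ n, y = conjSeq x σ k}

theorem conjSeq_mem {k : ℕ} (hk : k ≤ n) : conjSeq x σ k ∈ conjSubgroup n x σ :=
  Subgroup.subset_closure ⟨k, hk, rfl⟩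

theorem mem_normalizer_closure {S : Set G} {g : G} (h1 : ∀ s ∈ S, g * s * g⁻¹ ∈ Subgroup.closure S)
    (h2 : ∀ s ∈ S, g⁻¹ * s * g ∈ Subgroup.closure S) :
    g ∈ Subgroup.normalizer (Subgroup.closure S : Set G) := by
  have key (g : G) (h1 : ∀ s ∈ S, g * s * g⁻¹ ∈ Subgroup.closure S) (s : G)
      (hs : s ∈ Subgroup.closure S) : g * s * g⁻¹ ∈ Subgroup.closure S := by
    have : Subgroup.closure S ≤ (Subgroup.closure S).comap (MulAut.conj g).toMonoidHom :=
      (Subgroup.closure_le _).mpr h1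
    exact this hs
  refine Subgroup.mem_normalizer_iff.mpr fun s => ⟨key g h1 s, fun hs => ?_⟩
  have := key g⁻¹ (by simpa using h2) _ hs
  simpa [mul_assoc] using this

namespace IsTypeB

variable (h : IsTypeB n x σ)
include h

/-- Conjugation by σ_i sends x_i to x_{i+1} and x_{i+1} to x_{i+1}⁻¹ x_i x_{i+1}, and fixes the
other x_k. -/
theorem mem_normalizer {i : ℕ} (hi : i < n) :
    σ i ∈ Subgroup.normalizer (conjSubgroup n x σ : Set G) := by
  have hc := h.conj_conjSeq_succ hi
  have m0 : conjSeq x σ i ∈ conjSubgroup n x σ := conjSeq_mem hi.le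
  have m1 : conjSeq x σ (i + 1) ∈ conjSubgroup n x σ := conjSeq_mem hi
  have comm {k : ℕ} (hk : k ≤ n) (h1 : k ≠ i) (h2 : k ≠ i + 1) :
      Commute (σ i) (conjSeq x σ k) := by
    rcases Nat.lt_or_gt_of_ne h1 with h1 | h1
    · exact h.conjSeq_comm_of_lt h1 hi
    · exact h.conjSeq_comm_of_gt (by omega) hk
  refine mem_normalizer_closure ?_ ?_
  · rintro _ ⟨k, hk, rfl⟩
    by_cases h1 : k = i
    · subst h1; exact m1
    by_cases h2 : k = i + 1
    · subst h2
      rw [hc]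
      exact mul_mem (mul_mem (inv_mem m1) m0) m1
    · rw [(comm hk h1 h2).eq, mul_inv_cancel_right]
      exact conjSeq_mem hk
  · rintro _ ⟨k, hk, rfl⟩
    by_cases h1 : k = i
    · subst h1
      have : (σ k)⁻¹ * conjSeq x σ k * σ k =
          conjSeq x σ k * conjSeq x σ (k + 1) * (conjSeq x σ k)⁻¹ := by
        have e : conjSeq x σ k = (σ k)⁻¹ * conjSeq x σ (k + 1) * σ k := by rw [conjSeq]; group
        calc _ = (σ k)⁻¹ * (conjSeq x σ (k + 1) * ((conjSeq x σ (k + 1))⁻¹ * conjSeq x σ k *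
              conjSeq x σ (k + 1)) * (conjSeq x σ (k + 1))⁻¹) * σ k := by group
          _ = ((σ k)⁻¹ * conjSeq x σ (k + 1) * σ k) * conjSeq x σ (k + 1) *
              ((σ k)⁻¹ * conjSeq x σ (k + 1) * σ k)⁻¹ := by rw [← hc]; group
          _ = _ := by rw [← e]
      rw [this]
      exact mul_mem (mul_mem m0 m1) (inv_mem m0)
    by_cases h2 : k = i + 1
    · subst h2
      have : (σ i)⁻¹ * conjSeq x σ (i + 1) * σ i = conjSeq x σ i := by rw [conjSeq]; group
      rw [this]
      exact m0
    · rw [mul_assoc, ← (comm hk h1 h2).eq, inv_mul_cancel_left]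
      exact conjSeq_mem hk

theorem conjSubgroup_normal
    (hgen : ∀ K : Subgroup G, x ∈ K → (∀ i < n, σ i ∈ K) → K = ⊤) : (conjSubgroup n x σ).Normal :=
  Subgroup.normalizer_eq_top_iff.mp <| hgen _
    (Subgroup.le_normalizer (conjSeq_mem (Nat.zero_le n))) fun _ hi => h.mem_normalizer hi

variable {K : Subgroup G} (hδ : 0 < n → x⁻¹ * σ 0 * x * σ 0 ∈ K)
  (hK : ∀ i, i + 1 < n → σ (i + 1) ∈ K)
include hδ hK

/-- This is what returns the coset of σ_i⋯σ₀ to that of σ_{i-1}⋯σ₀ under σ_i. For i = 0 it is σ₀² =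
x₁⁻¹ x₀ δ with δ = x⁻¹ σ₀ x σ₀; the element for i + 1 is the one for i conjugated by σ_{i+1} ∈ K. -/
theorem descProd_conj_sq_mem {i : ℕ} (hi : i < n) :
    (descProd σ i)⁻¹ * (σ i * σ i) * descProd σ i ∈ conjSubgroup n x σ ⊔ K := by
  induction i with
  | zero =>
    have : (descProd σ 0)⁻¹ * (σ 0 * σ 0) * descProd σ 0 =
        ((conjSeq x σ 1)⁻¹ * conjSeq x σ 0) * (x⁻¹ * σ 0 * x * σ 0) := by
      simp [descProd, conjSeq, mul_assoc]
    rw [this]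
    exact mul_mem (Subgroup.mem_sup_left (mul_mem (inv_mem (conjSeq_mem hi))
      (conjSeq_mem (Nat.zero_le n)))) (Subgroup.mem_sup_right (hδ hi))
  | succ i ih =>
    have hm : σ (i + 1) ∈ conjSubgroup n x σ ⊔ K := Subgroup.mem_sup_right (hK i hi)
    have hb : (σ i)⁻¹ * σ (i + 1) * σ i = σ (i + 1) * σ i * (σ (i + 1))⁻¹ := by
      calc _ = (σ i)⁻¹ * (σ (i + 1) * σ i * σ (i + 1)) * (σ (i + 1))⁻¹ := by group
        _ = _ := by rw [← h.braid i hi]; group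
    have : (descProd σ (i + 1))⁻¹ * (σ (i + 1) * σ (i + 1)) * descProd σ (i + 1) =
        σ (i + 1) * ((descProd σ i)⁻¹ * (σ i * σ i) * descProd σ i) * (σ (i + 1))⁻¹ := by
      have hc' : (descProd σ i)⁻¹ * σ (i + 1) = σ (i + 1) * (descProd σ i)⁻¹ :=
        (h.descProd_comm_of_lt (Nat.lt_succ_self i) hi).inv_right.eq.symm
      have hc'' : (σ (i + 1))⁻¹ * descProd σ i = descProd σ i * (σ (i + 1))⁻¹ :=
        (h.descProd_comm_of_lt (Nat.lt_succ_self i) hi).inv_left.eq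
      rw [descProd]
      calc _ = (descProd σ i)⁻¹ * ((σ i)⁻¹ * σ (i + 1) * σ i) *
            ((σ i)⁻¹ * σ (i + 1) * σ i) * descProd σ i := by group
        _ = ((descProd σ i)⁻¹ * σ (i + 1)) * (σ i * σ i) *
            ((σ (i + 1))⁻¹ * descProd σ i) := by rw [hb]; group
        _ = _ := by rw [hc', hc'']; group
    rw [this]
    exact mul_mem (mul_mem hm (ih (by omega))) (inv_mem hm)

open Pointwise in
/-- The products `σ_{k-1} ⋯ σ₀` represent all cosets of the subgroup generated by `K` and the
`x_k`. -/
theorem exists_eq_descProd_mul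
    (hgen : ∀ K : Subgroup G, x ∈ K → (∀ i < n, σ i ∈ K) → K = ⊤) (g : G) : ∃ k ≤ n, ∃ a ∈ conjSubgroup n x σ, ∃ b ∈ K,
    g = descProd σ k * a * b := by
  have hN := h.conjSubgroup_normal hgen
  let L := conjSubgroup n x σ ⊔ K
  let X : Set (G ⧸ L) := (fun k => ((descProd σ k : G) : G ⧸ L)) '' Set.Iic n
  have hX : X.Finite := (Set.finite_Iic n).image _
  have mk_mem {a : G} (k : ℕ) (hk : k ≤ n) (ha : (descProd σ k)⁻¹ * a ∈ L) :
      (a : G ⧸ L) ∈ X := ⟨k, hk, QuotientGroup.eq.mpr ha⟩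
  -- As X is finite, it is enough that each generator maps X into itself; then X contains the orbit
  -- of the trivial coset, which is everything.
  have hstab : MulAction.stabilizer G X = ⊤ := by
    refine hgen _ ?_ fun i hi => ?_
    · refine (MulAction.mem_stabilizer_set_iff_smul_set_subset hX).mpr ?_
      rintro _ ⟨_, ⟨k, hk, rfl⟩, rfl⟩
      refine mk_mem k hk (Subgroup.mem_sup_left ?_)
      have := hN.conj_mem _ (conjSeq_mem (x := x) (σ := σ) (Nat.zero_le n)) (descProd σ k)⁻¹
      rw [inv_inv] at this
      simpa [mul_assoc, conjSeq] using this
    · refine (MulAction.mem_stabilizer_set_iff_smul_set_subset hX).mpr ?_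
      rintro _ ⟨_, ⟨k, hk, rfl⟩, rfl⟩
      have hk : k ≤ n := hk
      show ((σ i * descProd σ k : G) : G ⧸ L) ∈ X
      rcases lt_or_ge k i with h1 | h1
      · refine mk_mem k hk (Subgroup.mem_sup_right ?_)
        rw [(h.descProd_comm_of_lt h1 hi).eq, inv_mul_cancel_left]
        have := hK (i - 1) (by omega)
        rwa [Nat.sub_add_cancel (by omega)] at this
      rcases h1.eq_or_lt with rfl | h1
      · refine mk_mem (i + 1) hi ?_
        rw [descProd, inv_mul_cancel]
        exact one_mem _
      rcases Nat.eq_or_lt_of_le h1 with rfl | h1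
      · refine mk_mem i hi.le ?_
        have := h.descProd_conj_sq_mem hδ hK hi
        simpa [descProd, mul_assoc] using this
      · refine mk_mem k hk (Subgroup.mem_sup_right ?_)
        rw [h.mul_descProd_of_gt h1 hk, inv_mul_cancel_left]
        exact hK i (by omega)
  have hg : g ∈ MulAction.stabilizer G X := hstab ▸ Subgroup.mem_top g
  have h1 : ((1 : G) : G ⧸ L) ∈ X := mk_mem 0 (Nat.zero_le n) (by simp [descProd])
  have h2 : ((g * 1 : G) : G ⧸ L) ∈ X := by
    rw [MulAction.mem_stabilizer_iff] at hg
    rw [← hg]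
    exact Set.smul_mem_smul_set h1
  obtain ⟨k, hk, hkg⟩ := h2
  obtain ⟨a, ha, b, hb, hab⟩ := Subgroup.mem_sup_of_normal_left.mp (QuotientGroup.eq.mp hkg)
  refine ⟨k, hk, a, ha, b, hb, ?_⟩
  rw [mul_assoc, hab]; group

end IsTypeB

end Cosets

/-! ### The extension by the rotation and its fixed points -/

section Extension

variable {e r : ℕ}

/-- The semidirect product of `B(e,e,r)` with the cyclic group generated by the rotation. -/
abbrev ExtBraidGroup (r : ℕ) {e : ℕ} (he : e ≠ 0) : Type :=
  SemidirectProduct (BraidGroup e r) (Multiplicative (ZMod e))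
    (cyclicLift (down r he) (down_pow_self he))

/-- The elements `t₀, s₃, s₄, …` of `B(e,e,r)`. -/
def tsSeq (e r : ℕ) : ℕ → BraidGroup e r
  | 0 => circle e r 0
  | k + 1 => sSeq e r k

variable (he : e ≠ 0)

/-- The rotation, as an element of the extension of `B(e,e,r)`. -/
def rot (r : ℕ) : ExtBraidGroup r he := SemidirectProduct.inr (cyclicGen e)

theorem rot_pow : rot he r ^ e = 1 := by
  rw [rot, ← map_pow, cyclicGen_pow, map_one]

theorem rot_conj (b : BraidGroup e r) : rot he r * SemidirectProduct.inl b * (rot he r)⁻¹ =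
    SemidirectProduct.inl (down r he b) := by
  rw [rot, ← map_inv, ← SemidirectProduct.inl_aut, cyclicLift_gen]

theorem rot_commute_iff (b : BraidGroup e r) :
    Commute (rot he r) (SemidirectProduct.inl b) ↔ down r he b = b := by
  rw [← SemidirectProduct.inl_inj (φ := cyclicLift (down r he) (down_pow_self he)), ← rot_conj, mul_inv_eq_iff_eq_mul]
  rfl

theorem down_sSeq (i : ℕ) : down r he (sSeq e r i) = sSeq e r i := by
  unfold sSeq
  split_ifs
  · exact down_s he _
  · exact map_one _

theorem down_delta : down r he (delta e r) = delta e r := by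
  have : delta e r = circle e r 2 * circle e r 1 := by
    rw [delta, circle_succ 1, inv_mul_cancel_right]
  conv_lhs => rw [this]
  rw [map_mul, down_circle_succ, down_circle_succ, delta]

theorem rot_inv_conj : (rot he r)⁻¹ * SemidirectProduct.inl (circle e r 0) * rot he r =
    SemidirectProduct.inl (circle e r 1) := by
  rw [← down_circle_succ he 0, ← rot_conj]; group

theorem isTypeB_rot (hr : 2 ≤ r) :
    IsTypeB (r - 1) (rot he r) fun i => SemidirectProduct.inl (tsSeq e r i) where
  braid i hi := by
    rw [← map_mul, ← map_mul, ← map_mul, ← map_mul]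
    congr 1
    match i, hi with
    | 0, hi =>
      simp only [tsSeq]
      rw [sSeq_of_le (by omega)]
      exact (Rel.mk_eq (.st_braid (e := e) ⟨3, by simp; omega⟩ rfl 0)).symm
    | i + 1, hi => exact sSeq_braid (by omega)
  comm i j hij hj := by
    refine Commute.map ?_ _
    match i, j, hij with
    | 0, j + 1, hij => exact circle_zero_comm (by omega) (by omega)
    | i + 1, j + 1, hij => exact sSeq_comm (by omega) (by omega)
  comm_x i hi _ := by
    obtain ⟨k, rfl⟩ := Nat.exists_eq_add_of_le' hi
    exact (rot_commute_iff he _).mpr (down_sSeq he k)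
  sq _ := by
    have h1 := rot_inv_conj (r := r) he
    have h2 := ((rot_commute_iff he _).mpr (down_delta (r := r) he)).eq
    simp only [tsSeq]
    rw [delta, map_mul, ← h1] at h2
    generalize (SemidirectProduct.inl (circle e r 0) : ExtBraidGroup r he) = a at *
    generalize rot he r = d at *
    calc _ = d * (d * (d⁻¹ * a * d * a)) := by group
      _ = _ := by rw [h2]; group

theorem ext_generated (hr : 2 ≤ r) (K : Subgroup (ExtBraidGroup r he)) (hx : rot he r ∈ K)
    (hs : ∀ i < r - 1, SemidirectProduct.inl (tsSeq e r i) ∈ K) : K = ⊤ := by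
  have h1 : K.comap SemidirectProduct.inl = ⊤ := by
    rw [eq_top_iff, ← PresentedGroup.closure_range_of, Subgroup.closure_le]
    rintro _ ⟨y, rfl⟩
    show SemidirectProduct.inl _ ∈ K
    match y with
    | .t 0 => exact hs 0 (by omega)
    | .t 1 =>
      have := mul_mem (mul_mem (inv_mem hx) (hs 0 (by omega))) hx
      rwa [tsSeq, rot_inv_conj] at this
    | .s ⟨j, hj⟩ =>
      have h3 : 3 ≤ j := hj.1
      have hjr : j ≤ r := hj.2
      have := hs (j - 3 + 1) (by omega)
      rw [tsSeq, sSeq_of_le (by omega)] at this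
      simp only [Nat.sub_add_cancel h3] at this
      exact this
  refine eq_top_iff.mpr fun g _ => ?_
  rw [← SemidirectProduct.inl_left_mul_inr_right g]
  refine mul_mem ?_ ?_
  · have : g.left ∈ K.comap SemidirectProduct.inl := h1 ▸ Subgroup.mem_top _
    exact this
  · obtain ⟨k, hk⟩ := exists_zpow_cyclicGen g.right
    rw [hk, map_zpow]
    exact zpow_mem hx k

open CyclicFreeProd

/-- The action of `B(e,e,r)` on the free product of cyclic groups. -/
def toHolomorph (hr : 2 ≤ r) : BraidGroup e r →* Holomorph e :=
  (isTypeB_holomorph e (r - 1)).braidLift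
    (by rw [← map_pow, gen_pow, map_one]) he hr

theorem toHolomorph_tsSeq (hr : 2 ≤ r) {i : ℕ} (hi : i < r - 1) :
    toHolomorph he hr (tsSeq e r i) = SemidirectProduct.inr (artin e i) := by
  match i, hi with
  | 0, hi => exact IsTypeB.braidLift_t_zero _ _ _ _
  | i + 1, hi =>
    rw [tsSeq, sSeq_of_le (by omega)]
    exact IsTypeB.braidLift_s _ _ _ _ _

/-- On the free product the rotation becomes conjugation by the generator x₀. This is checked for
the inverse rotation on t₀, t₁ and the s_j, where t₁ ↦ x₀⁻¹ t₀ x₀ by construction. -/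
theorem toHolomorph_down (hr : 2 ≤ r) (b : BraidGroup e r) :
    toHolomorph he hr (down r he b) =
      SemidirectProduct.inl (gen e 0) * toHolomorph he hr b *
        (SemidirectProduct.inl (gen e 0))⁻¹ := by
  have hB := isTypeB_holomorph e (r - 1)
  set x : Holomorph e := SemidirectProduct.inl (gen e 0) with hx
  have c0 : toHolomorph he hr (circle e r 0) = SemidirectProduct.inr (artin e 0) :=
    IsTypeB.braidLift_t_zero _ _ _ _
  have c1 : toHolomorph he hr (circle e r 1) =
      x⁻¹ * SemidirectProduct.inr (artin e 0) * x := IsTypeB.braidLift_t_one _ _ _ _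
  have hd := (hB.delta_comm (by omega)).inv_left.eq
  have key : (toHolomorph he hr).comp (up r he : BraidGroup e r →* BraidGroup e r) =
      (MulAut.conj x⁻¹).toMonoidHom.comp (toHolomorph he hr) := by
    refine braidGroup_hom_ext ?_ ?_ fun j => ?_
    · show toHolomorph he hr (up r he (circle e r 0)) = x⁻¹ * toHolomorph he hr (circle e r 0) * x⁻¹⁻¹
      rw [up_circle, zero_add, c0, c1, inv_inv]
    · show toHolomorph he hr (up r he (circle e r 1)) = x⁻¹ * toHolomorph he hr (circle e r 1) * x⁻¹⁻¹
      rw [up_circle, circle_succ, map_mul, map_mul, map_inv, c0, c1, inv_inv]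
      calc _ = (x⁻¹ * SemidirectProduct.inr (artin e 0) * x * SemidirectProduct.inr (artin e 0)) *
            x⁻¹ * (SemidirectProduct.inr (artin e 0))⁻¹ * x := by group
        _ = _ := by rw [← hd]; group
    · show toHolomorph he hr (up r he (s e j)) = x⁻¹ * toHolomorph he hr (s e j) * x⁻¹⁻¹
      have hj := j.2.1
      have hj' := j.2.2
      have hs : toHolomorph he hr (s e j) = SemidirectProduct.inr (artin e (j - 2)) :=
        IsTypeB.braidLift_s _ _ _ _ _
      have := (hB.comm_x (j - 2) (by omega) (by omega)).inv_left.eq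
      rw [up_s, hs, inv_inv, this, inv_mul_cancel_right]
  obtain ⟨c, rfl⟩ := (down r he).symm.surjective b
  have h2 : toHolomorph he hr (up r he c) = x⁻¹ * toHolomorph he hr c * x⁻¹⁻¹ :=
    DFunLike.congr_fun key c
  rw [MulEquiv.apply_symm_apply, down_symm_apply, h2]; group

/-- The action of the extension of `B(e,e,r)` on the free product of cyclic groups, where the
rotation acts by an inner automorphism. -/
def extToHolomorph (hr : 2 ≤ r) : ExtBraidGroup r he →* Holomorph e :=
  SemidirectProduct.lift (toHolomorph he hr)
    (cyclicLift (SemidirectProduct.inl (gen e 0)) (by rw [← map_pow, gen_pow, map_one])) <| by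
    have key : ∀ k : ℕ, ∀ b : BraidGroup e r, toHolomorph he hr ((down r he ^ k) b) =
        (SemidirectProduct.inl (gen e 0)) ^ k * toHolomorph he hr b *
          ((SemidirectProduct.inl (gen e 0)) ^ k)⁻¹ := by
      intro k
      induction k with
      | zero => simp
      | succ k ih =>
        intro b
        rw [pow_succ', MulAut.mul_apply, toHolomorph_down, ih]; group
    intro g
    refine MonoidHom.ext fun b => ?_
    have : NeZero e := ⟨he⟩
    obtain ⟨k, hk⟩ := ZMod.natCast_zmod_surjective g.toAdd
    obtain rfl : g = cyclicGen e ^ k := by rw [cyclicGen, ← ofAdd_nsmul]; simp [hk]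
    rw [map_pow, map_pow, cyclicLift_gen, cyclicLift_gen]
    exact key k b

theorem extToHolomorph_rot (hr : 2 ≤ r) :
    extToHolomorph he hr (rot he r) = SemidirectProduct.inl (gen e 0) := by
  rw [extToHolomorph, rot, SemidirectProduct.lift_inr, cyclicLift_gen]

theorem extToHolomorph_conjSeq (hr : 2 ≤ r) {k : ℕ} (hk : k ≤ r - 1) :
    extToHolomorph he hr (conjSeq (rot he r) (fun i => SemidirectProduct.inl (tsSeq e r i)) k) =
      SemidirectProduct.inl (gen e k) := by
  rw [map_conjSeq, ← conjSeq_holomorph]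
  refine conjSeq_congr (extToHolomorph_rot he hr) fun i hi => ?_
  rw [extToHolomorph, SemidirectProduct.lift_inl, toHolomorph_tsSeq he hr (by omega)]

/-- The homomorphism from the free product of cyclic groups to the extension of `B(e,e,r)`. -/
def freeProdToExt (r : ℕ) : CyclicFreeProd e →* ExtBraidGroup r he :=
  CyclicFreeProd.lift (conjSeq (rot he r) fun i => SemidirectProduct.inl (tsSeq e r i))
    (conjSeq_pow (rot_pow he))

/-- Identifies N with part of the free product: `freeProdToExt` covers N, and `extToHolomorph`
recovers the chosen preimage, since both match x_k with the k-th generator for k ≤ r - 1. -/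
theorem exists_lift_of_mem_conjSubgroup (hr : 2 ≤ r) {g : ExtBraidGroup r he}
    (hg : g ∈ conjSubgroup (r - 1) (rot he r) fun i => SemidirectProduct.inl (tsSeq e r i)) :
    ∃ p, freeProdToExt he r p = g ∧ extToHolomorph he hr g = SemidirectProduct.inl p := by
  induction hg using Subgroup.closure_induction with
  | mem g hg =>
    obtain ⟨k, hk, rfl⟩ := hg
    exact ⟨gen e k, lift_gen _ _ k, extToHolomorph_conjSeq he hr hk⟩
  | one => exact ⟨1, map_one _, by rw [map_one, map_one]⟩
  | mul a b _ _ ha hb =>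
    obtain ⟨p, hp, hp'⟩ := ha
    obtain ⟨q, hq, hq'⟩ := hb
    exact ⟨p * q, by rw [map_mul, hp, hq], by rw [map_mul, map_mul, hp', hq']⟩
  | inv a _ ha =>
    obtain ⟨p, hp, hp'⟩ := ha
    exact ⟨p⁻¹, by rw [map_inv, hp], by rw [map_inv, map_inv, hp']⟩

/-- The fixed points of the rotation are the elements of the embedded Artin group. -/
theorem range_artinLift (he2 : 2 ≤ e) (hr : 2 ≤ r) :
    (isTypeB_delta e r).artinLift.range = fixedSubgroup (down r he) := by
  have mem_fixed (b : BraidGroup e r) : b ∈ fixedSubgroup (down r he) ↔ down r he b = b := Iff.rfl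
  have hle : (isTypeB_delta e r).artinLift.range ≤ fixedSubgroup (down r he) := by
    rw [MonoidHom.range_eq_map, Subgroup.map_le_iff_le_comap, top_le_iff]
    refine artin_closure hr ?_ fun i hi => ?_
    · rw [Subgroup.mem_comap, IsTypeB.artinLift_X, mem_fixed, down_delta]
    · rw [Subgroup.mem_comap, IsTypeB.artinLift_S _ hi, mem_fixed, down_sSeq]
  refine le_antisymm hle fun b hb => ?_
  have hB := isTypeB_rot he hr
  have hgen := ext_generated he hr
  have hN := hB.conjSubgroup_normal hgen
  obtain ⟨k, hk, a, ha, c, ⟨h, hh, rfl⟩, hg⟩ := hB.exists_eq_descProd_mul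
    (K := (isTypeB_delta e r).artinLift.range.map SemidirectProduct.inl)
    (fun _ => ⟨delta e r, ⟨artinX hr, IsTypeB.artinLift_X _ hr⟩, by
      rw [delta, map_mul, ← rot_inv_conj he]; rfl⟩)
    (fun i hi => ⟨sSeq e r i, ⟨artinS r i, IsTypeB.artinLift_S _ (by omega)⟩, rfl⟩)
    hgen (SemidirectProduct.inl b)
  have hbc := ((rot_commute_iff he b).mpr hb).eq
  have hhc := ((rot_commute_iff he h).mpr (hle hh)).eq
  have hconj := conjSeq_eq (rot he r) (fun i => SemidirectProduct.inl (tsSeq e r i)) k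
  have hmem := hN.conj_mem a ha (descProd (fun i => SemidirectProduct.inl (tsSeq e r i)) k)
  obtain ⟨p, -, hp⟩ := exists_lift_of_mem_conjSubgroup he hr hmem
  -- Since b and h commute with x = `rot`, so does w a, with w = σ_{k-1}⋯σ₀. Hence x = (w a w⁻¹) x_k
  -- (w a w⁻¹)⁻¹ with w a w⁻¹ ∈ N, an equation that can be read in the free product.
  have hk0 : k = 0 := by
    refine not_isConj_gen he2 (p := p) (SemidirectProduct.inl_injective (φ := MonoidHom.id _) ?_)
    rw [map_mul, map_mul, map_inv, ← hp, ← extToHolomorph_conjSeq he hr hk,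
      ← extToHolomorph_rot he hr, ← map_inv, ← map_mul, ← map_mul, hconj]
    congr 1
    generalize descProd (fun i => (SemidirectProduct.inl (tsSeq e r i) : ExtBraidGroup r he)) k =
      w at *
    have : a * SemidirectProduct.inl h = w⁻¹ * SemidirectProduct.inl b := by rw [hg]; group
    calc _ = w * a * rot he r * SemidirectProduct.inl h *
          (SemidirectProduct.inl h)⁻¹ * a⁻¹ * w⁻¹ := by group
      _ = w * (a * SemidirectProduct.inl h) * rot he r *
          (a * SemidirectProduct.inl h)⁻¹ * w⁻¹ := by rw [mul_assoc (w * a), hhc]; group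
      _ = SemidirectProduct.inl b * rot he r * (SemidirectProduct.inl b)⁻¹ := by
          rw [this]; group
      _ = rot he r := by rw [← hbc, mul_inv_cancel_right]
  subst hk0
  rw [descProd, one_mul] at hg
  obtain ⟨q, hq, hq'⟩ := exists_lift_of_mem_conjSubgroup he hr ha
  have haeq : a = SemidirectProduct.inl (b * h⁻¹) := by
    rw [map_mul, map_inv, hg, mul_inv_cancel_right]
  have hac : Commute (rot he r) a := by
    have : down r he (b * h⁻¹) = b * h⁻¹ := by 
      rw [map_mul, map_inv, (mem_fixed b).mp hb, (mem_fixed h).mp (hle hh)]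
    rw [haeq]
    exact (rot_commute_iff he _).mpr this
  have hqc : Commute (gen e 0) q := by
    have := (hac.map (extToHolomorph he hr)).eq
    rw [extToHolomorph_rot, hq', ← map_mul, ← map_mul, SemidirectProduct.inl_inj] at this
    exact this
  obtain ⟨z, rfl⟩ := eq_zpow_of_commute_gen he2 hqc
  have hz : a = SemidirectProduct.inr (cyclicGen e ^ z) := by
    rw [← hq, map_zpow, freeProdToExt, lift_gen, map_zpow]; rfl
  -- Here a is both a power of the rotation and an element of B(e,e,r), two subgroups that meet
  -- trivially.
  have h1 : cyclicGen e ^ z = 1 := by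
    have := congrArg SemidirectProduct.right (hz.symm.trans haeq)
    rwa [SemidirectProduct.right_inr, SemidirectProduct.right_inl] at this
  rw [h1, map_one] at hz
  rw [hz, one_mul, SemidirectProduct.inl_inj] at hg
  rw [hg]
  exact hh

end Extension

end BraidEER

theorem proposition2p3 (e r : ℕ) (he : 2 ≤ e) (hr : 2 ≤ r) :
    ∃ down : BraidEER.BraidGroup e r ≃* BraidEER.BraidGroup e r,
      (∀ i : ZMod e, down (BraidEER.t e r i) = BraidEER.t e r (i - 1)) ∧
      (∀ j : Set.Icc 3 r, down (BraidEER.s e j) = BraidEER.s e j) ∧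
      Nonempty (BraidEER.fixedSubgroup down ≃*
        BraidEER.ArtinGroup (CoxeterMatrix.B (r - 1))) := by
  have he0 : e ≠ 0 := by omega
  refine ⟨BraidEER.down r he0, BraidEER.down_t he0, BraidEER.down_s he0, ⟨?_⟩⟩
  exact ((MonoidHom.ofInjective (BraidEER.artinLift_injective he0 hr)).trans
    (MulEquiv.subgroupCongr (BraidEER.range_artinLift he0 he hr))).symm
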